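/- An action of \(a\) and \(b\) on a \(\mathbb{C}[[b]]\)-module \(E\) is given by a \(\mathbb{C}\)-linear map \(a:E\to E\) with \(a(Sx)=S\,a(x)+b^2S'x\) for all \(S\in\mathbb{C}[[b]]\), \(x\in E\). Below, submodules are \(a\)-stable \(\mathbb{C}[[b]]\)-submodules, and morphisms are \(\mathbb{C}[[b]]\)-linear maps commuting with \(a\). An (a,b)-module is such an \(E\) which is free of finite rank over \(\mathbb{C}[[b]]\). It has a simple pole if \(aE\subset bE\); it is regular if it embeds in an (a,b)-module with a simple pole, and then \(E^\sharp\) denotes the smallest simple pole (a,b)-module containing it. The Bernstein polynomial of a regular \(E\) is the minimal polynomial of \(-b^{-1}a\) acting on \(E^\sharp/bE^\sharp\); for \(\lambda\in\mathbb{Q}\cap\,]0,1]\), \(E\) is \([\lambda]\)-primitive if all roots of this polynomial lie in \(-\lambda+\mathbb{Z}\). The module \(E\) is semi-simple if it is isomorphic to a submodule of a finite direct sum of regular (a,b)-modules of rank one. A fresco is a module isomorphic to the submodule generated by one element of \(\Xi_\Lambda^{(N)}\otimes_{\mathbb C} V\), where \(\Lambda\subset\mathbb{Q}\cap\,]0,1]\)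 is finite, \(N\in\mathbb{N}\), \(V\) is a finite dimensional complex vector space, and \(\Xi_\Lambda^{(N)}=\bigoplus_{\lambda\in\Lambda}\bigoplus_{j=0}^N\mathbb{C}[[b]]\,s^{\lambda-1}(\log s)^j\) is the module of formal asymptotic expansions on which \(a\) is multiplication by \(s\) and \(b\) is the primitive in \(s\) without constant term. For \(\mu\in\mathbb{C}\) let \(E_\mu=\mathbb{C}[[b]]\,e_\mu\) with \(a\,e_\mu=\mu\,b\,e_\mu\). A Jordan–Hölder sequence of \(E\) is a sequence \(0=F_0\subset F_1\subset\dots\subset F_k=E\) of submodules which are normal (\(F_j\cap bE=bF_j\)) with all quotients \(F_j/F_{j-1}\) of rank one; it corresponds to the numbers \(\mu_1,\dots,\mu_k\) if \(F_j/F_{j-1}\simeq E_{\mu_j}\) for all \(j\in[1,k]\). A sequence \(\mu_1,\dots,\mu_k\) is a twisted permutation of \(\nu_1,\dots,\nu_k\) if the sequence \((\mu_j+j)_{j\in[1,k]}\) is a permutation of \((\nu_j+j)_{j\in[1,k]}\). Proposition. (1) Let \(\lambda\in\mathbb{Q}\cap\,]0,1]\) and let \(E\) be a \([\lambda]\)-primitive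 fresco. Then \(E\) is semi-simple if and only if it admits a Jordan–Hölder sequence corresponding to rational numbers \(\mu_1,\dots,\mu_k\) such that the sequence \(\mu_j+j\), \(j\in[1,k]\), is strictly decreasing. (2) Let \(E\) be a semi-simple fresco. Then \(E\) admits a Jordan–Hölder sequence with associated numbers, and whenever \(\nu_1,\dots,\nu_k\) are the numbers corresponding to some Jordan–Hölder sequence of \(E\) and \(\mu_1,\dots,\mu_k\) is a twisted permutation of \(\nu_1,\dots,\nu_k\), there exists a Jordan–Hölder sequence of \(E\) corresponding to \(\mu_1,\dots,\mu_k\). -/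

import Mathlib

open scoped PowerSeries

noncomputable section

namespace ABTheory

/-- The action of the operators `a` and `b` on `E`.  The variable `X` of `ℂ⟦X⟧` acts as `b`, and `a` is a
`ℂ`-linear endomorphism with `a ∘ S = S ∘ a + b² S'` for `S ∈ ℂ[[b]]` (in particular `ab - ba = b²`). -/
class ABAction (E : Type*) [AddCommGroup E] [Module ℂ E] [Module ℂ⟦X⟧ E]
    [IsScalarTower ℂ ℂ⟦X⟧ E] where
  a : E →ₗ[ℂ] E
  a_smul : ∀ (S : ℂ⟦X⟧) (x : E),
    a (S • x) = S • a x + ((PowerSeries.X : ℂ⟦X⟧) ^ 2 * PowerSeries.derivative ℂ S) • x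

open ABAction (a)

/-- An (a,b)-module: a free `ℂ[[b]]`-module of finite rank with an operator `a` as above.
Every free `ℂ[[b]]`-module of finite rank is isomorphic to some `ℂ[[b]]ⁿ`, so that the universe `Type`
contains all (a,b)-modules up to isomorphism. -/
structure ABModule where
  carrier : Type
  [addCommGroup : AddCommGroup carrier]
  [moduleC : Module ℂ carrier]
  [moduleCb : Module ℂ⟦X⟧ carrier]
  [tower : IsScalarTower ℂ ℂ⟦X⟧ carrier]
  [action : ABAction carrier]
  [free : Module.Free ℂ⟦X⟧ carrier]
  [finite : Module.Finite ℂ⟦X⟧ carrier]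

instance : CoeSort ABModule Type := ⟨ABModule.carrier⟩

attribute [instance] ABModule.addCommGroup ABModule.moduleC ABModule.moduleCb ABModule.tower
  ABModule.action ABModule.free ABModule.finite

section General

variable (E : Type*) [AddCommGroup E] [Module ℂ E] [Module ℂ⟦X⟧ E] [IsScalarTower ℂ ℂ⟦X⟧ E]
  [ABAction E]
variable (F : Type*) [AddCommGroup F] [Module ℂ F] [Module ℂ⟦X⟧ F] [IsScalarTower ℂ ℂ⟦X⟧ F]
  [ABAction F]

/-- Morphisms: `ℂ[[b]]`-linear maps that commute with `a`. -/
structure ABHom extends E →ₗ[ℂ⟦X⟧] F where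
  map_a : ∀ x, toFun (a x) = a (toFun x)

/-- Isomorphisms: bijective `ℂ[[b]]`-linear maps that commute with `a`. -/
structure ABIso extends E ≃ₗ[ℂ⟦X⟧] F where
  map_a : ∀ x, toFun (a x) = a (toFun x)

/-- Submodules: `ℂ[[b]]`-submodules that are stable under `a`. -/
structure ABSub extends Submodule ℂ⟦X⟧ E where
  a_mem : ∀ x ∈ carrier, a x ∈ carrier

variable {E}

instance (G : ABSub E) : ABAction G.toSubmodule where
  a := ((a : E →ₗ[ℂ] E).comp (G.toSubmodule.subtype.restrictScalars ℂ)).codRestrict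
    (G.toSubmodule.restrictScalars ℂ) (fun x => G.a_mem x.1 x.2)
  a_smul S x := Subtype.ext (ABAction.a_smul S x.1)

instance (G : ABSub E) : ABAction (E ⧸ G.toSubmodule) where
  a := (G.toSubmodule.restrictScalars ℂ).mapQ (G.toSubmodule.restrictScalars ℂ) a
    (fun x hx => G.a_mem x hx)
  a_smul S x := by
    obtain ⟨y, rfl⟩ := G.toSubmodule.mkQ_surjective x
    exact congrArg G.toSubmodule.mkQ (ABAction.a_smul S y)

/-- `G ∩ H`, regarded as a submodule of `H`. -/
def ABSub.inside (G H : ABSub E) : ABSub H.toSubmodule where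
  toSubmodule := G.toSubmodule.comap H.toSubmodule.subtype
  a_mem x hx := G.a_mem x.1 hx

/-- The quotient `H / G` (for `G ⊆ H`). -/
abbrev ABSub.Quot (H G : ABSub E) : Type _ := H.toSubmodule ⧸ (G.inside H).toSubmodule

/-- The submodule generated by one element `x`: the smallest submodule that contains `x`. -/
def ABSub.gen (x : E) : ABSub E where
  toSubmodule := sInf {G : Submodule ℂ⟦X⟧ E | x ∈ G ∧ ∀ y ∈ G, a y ∈ G}
  a_mem y hy := by
    change y ∈ sInf {G : Submodule ℂ⟦X⟧ E | x ∈ G ∧ ∀ y ∈ G, a y ∈ G} at hy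
    change a y ∈ sInf {G : Submodule ℂ⟦X⟧ E | x ∈ G ∧ ∀ y ∈ G, a y ∈ G}
    rw [Submodule.mem_sInf] at hy ⊢
    exact fun G hG => hG.2 y (hy G hG)

/-- A submodule `G` of `E` is normal when `G ∩ bE = bG`. -/
def ABSub.IsNormal (G : ABSub E) : Prop :=
  ∀ x : E, (x ∈ G.toSubmodule ∧ ∃ y : E, x = (PowerSeries.X : ℂ⟦X⟧) • y) ↔
    ∃ z ∈ G.toSubmodule, x = (PowerSeries.X : ℂ⟦X⟧) • z

variable (E)

/-- `E` has a simple pole: `aE ⊆ bE`. -/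
def HasSimplePole : Prop := ∀ x : E, ∃ y : E, a x = (PowerSeries.X : ℂ⟦X⟧) • y

/-- `E` is regular: it embeds in an (a,b)-module with a simple pole. -/
def IsRegular : Prop :=
  ∃ (M : ABModule) (i : ABHom E M), Function.Injective i.toLinearMap ∧ HasSimplePole M

/-- On a direct sum (of finitely many modules) `a` acts componentwise. -/
instance instPi {ι : Type*} (M : ι → Type*) [∀ i, AddCommGroup (M i)] [∀ i, Module ℂ (M i)]
    [∀ i, Module ℂ⟦X⟧ (M i)] [∀ i, IsScalarTower ℂ ℂ⟦X⟧ (M i)] [∀ i, ABAction (M i)] :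
    ABAction (∀ i, M i) where
  a := LinearMap.pi fun i => (a : M i →ₗ[ℂ] M i).comp (LinearMap.proj i)
  a_smul S x := funext fun i => ABAction.a_smul S (x i)

/-- `E` is semi-simple: it is isomorphic to a submodule of a finite direct sum of regular (a,b)-modules of rank
one. -/
def IsSemisimple : Prop :=
  ∃ (n : ℕ) (M : Fin n → ABModule),
    (∀ i, IsRegular (M i) ∧ Module.finrank ℂ⟦X⟧ (M i) = 1) ∧
    ∃ f : ABHom E (∀ i, M i), Function.Injective f.toLinearMap

/-- Multiplication by `b` as a `ℂ`-linear map. -/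
def bMap : E →ₗ[ℂ] E := DistribSMul.toLinearMap ℂ E (PowerSeries.X : ℂ⟦X⟧)

end General

section Bernstein

variable (M : ABModule)

theorem b_cancel {x y : M} (h : (PowerSeries.X : ℂ⟦X⟧) • x = (PowerSeries.X : ℂ⟦X⟧) • y) : x = y :=
  smul_right_injective M PowerSeries.X_ne_zero h

/-- The operator `b⁻¹a` on an (a,b)-module with a simple pole. -/
def bInvA (h : HasSimplePole M) : M →ₗ[ℂ] M where
  toFun x := (h x).choose
  map_add' x y := b_cancel M (by
    rw [← (h (x + y)).choose_spec, smul_add, ← (h x).choose_spec, ← (h y).choose_spec, map_add])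
  map_smul' c x := b_cancel M (by
    rw [← (h (c • x)).choose_spec, RingHom.id_apply, smul_comm, ← (h x).choose_spec, map_smul])

theorem b_bInvA (h : HasSimplePole M) (x : M) :
    (PowerSeries.X : ℂ⟦X⟧) • bInvA M h x = a x := (h x).choose_spec.symm

/-- The endomorphism of `M / bM` induced by `b⁻¹a`. -/
def bInvAQuot (h : HasSimplePole M) : Module.End ℂ (M ⧸ LinearMap.range (bMap M)) :=
  (LinearMap.range (bMap M)).mapQ (LinearMap.range (bMap M)) (bInvA M h) (by
    rintro _ ⟨x, rfl⟩
    refine ⟨bInvA M h x + x, b_cancel M ?_⟩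
    rw [b_bInvA]
    change (PowerSeries.X : ℂ⟦X⟧) • ((PowerSeries.X : ℂ⟦X⟧) • (bInvA M h x + x)) =
      a ((PowerSeries.X : ℂ⟦X⟧) • x)
    rw [ABAction.a_smul, smul_add, b_bInvA, smul_add, smul_smul, ← pow_two]
    simp)

/-- The Bernstein polynomial of an (a,b)-module with a simple pole: the minimal polynomial of `-b⁻¹a`
acting on `M / bM`. -/
def simplePoleBernstein (h : HasSimplePole M) : Polynomial ℂ := minpoly ℂ (-bInvAQuot M h)

variable (E : Type*) [AddCommGroup E] [Module ℂ E] [Module ℂ⟦X⟧ E] [IsScalarTower ℂ ℂ⟦X⟧ E]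
  [ABAction E]

/-- `i : E → M` is the saturation of `E` by `b⁻¹a`: it is the minimal embedding of `E` in an (a,b)-module
with a simple pole, that is, `i` is injective, `M` has a simple pole, and no proper submodule of `M`
with a simple pole contains the image of `E`. -/
def IsSaturation {E : Type*} [AddCommGroup E] [Module ℂ E] [Module ℂ⟦X⟧ E]
    [IsScalarTower ℂ ℂ⟦X⟧ E] [ABAction E] {M : ABModule} (i : ABHom E M) : Prop :=
  Function.Injective i.toLinearMap ∧ HasSimplePole M ∧
    ∀ G : ABSub M, HasSimplePole G.toSubmodule → LinearMap.range i.toLinearMap ≤ G.toSubmodule →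
      G.toSubmodule = ⊤

/-- `B` is the Bernstein polynomial of `E`, i.e. that of its saturation (which is unique up to isomorphism,
and exists exactly when `E` is a regular (a,b)-module). -/
def IsBernsteinPolynomial (B : Polynomial ℂ) : Prop :=
  ∃ (M : ABModule) (h : HasSimplePole M) (i : ABHom E M),
    IsSaturation i ∧ B = simplePoleBernstein M h

/-- `E` is a regular (a,b)-module which is `[Λ]`-primitive: all roots of its Bernstein polynomial
lie in `-Λ + ℤ`. -/
def IsPrimitive (Λ : Set ℚ) : Prop :=
  ∃ B : Polynomial ℂ, IsBernsteinPolynomial E B ∧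
    ∀ ρ : ℂ, B.IsRoot ρ → ∃ l ∈ Λ, ∃ n : ℤ, ρ = -(l : ℂ) + (n : ℂ)

end Bernstein

/-- The rank one module `E_μ`, the quotient of the algebra generated by `a` and `ℂ[[b]]` by the left ideal
generated by `a - μb`: it is `ℂ[[b]] e` with `a e = μ b e`. -/
def RankOne (_μ : ℂ) : Type := ℂ⟦X⟧

namespace RankOne

variable (μ : ℂ)

instance : AddCommGroup (RankOne μ) := inferInstanceAs (AddCommGroup ℂ⟦X⟧)
instance : Module ℂ (RankOne μ) := inferInstanceAs (Module ℂ ℂ⟦X⟧)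
instance : Module ℂ⟦X⟧ (RankOne μ) := inferInstanceAs (Module ℂ⟦X⟧ ℂ⟦X⟧)
instance : IsScalarTower ℂ ℂ⟦X⟧ (RankOne μ) := inferInstanceAs (IsScalarTower ℂ ℂ⟦X⟧ ℂ⟦X⟧)

/-- `a (S e) = (b² S' + μ b S) e`. -/
def aFun : ℂ⟦X⟧ →ₗ[ℂ] ℂ⟦X⟧ :=
  LinearMap.mulLeft ℂ (PowerSeries.X ^ 2) ∘ₗ (PowerSeries.derivative ℂ).toLinearMap
    + μ • LinearMap.mulLeft ℂ PowerSeries.X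

theorem aFun_mul (S T : ℂ⟦X⟧) :
    aFun μ (S * T) = S * aFun μ T + PowerSeries.X ^ 2 * PowerSeries.derivative ℂ S * T := by
  simp only [aFun, LinearMap.add_apply, LinearMap.comp_apply, LinearMap.smul_apply,
    LinearMap.mulLeft_apply, Derivation.coeFn_coe, Derivation.leibniz, smul_eq_mul, mul_add,
    mul_smul_comm]
  rw [mul_left_comm S PowerSeries.X T]
  ring

instance : ABAction (RankOne μ) where
  a := aFun μ
  a_smul S T := aFun_mul μ S T

end RankOne

/-- The module `Ξ_Λ^{(N)} ⊗ ℂ^p` of formal asymptotic expansions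
`∑_{l ∈ Λ} ∑_{j ≤ N} ℂ[[s]] s^{l-1} (log s)^j ⊗ ℂ^p`, on which `a` is the multiplication by `s` and `b` is
the primitive in `s` without constant term.  It is free over `ℂ[[b]]` with basis
`e_{l,j,v} = s^{l-1} (log s)^j ⊗ v`, `v` in the standard basis of `ℂ^p`; an element is given by its
coordinates in this basis.  As `d/ds (s · s^{l-1} (log s)^j) = l s^{l-1} (log s)^j + j s^{l-1} (log s)^{j-1}`,
one has `a e_{l,j,v} = b (l e_{l,j,v} + j e_{l,j-1,v})`. -/
def Xi (Λ : Finset ℚ) (N p : ℕ) : Type := Λ → Fin (N + 1) → Fin p → ℂ⟦X⟧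

namespace Xi

variable (Λ : Finset ℚ) (N p : ℕ)

instance : AddCommGroup (Xi Λ N p) :=
  inferInstanceAs (AddCommGroup (Λ → Fin (N + 1) → Fin p → ℂ⟦X⟧))
instance : Module ℂ (Xi Λ N p) :=
  inferInstanceAs (Module ℂ (Λ → Fin (N + 1) → Fin p → ℂ⟦X⟧))
instance : Module ℂ⟦X⟧ (Xi Λ N p) :=
  inferInstanceAs (Module ℂ⟦X⟧ (Λ → Fin (N + 1) → Fin p → ℂ⟦X⟧))
instance : IsScalarTower ℂ ℂ⟦X⟧ (Xi Λ N p) :=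
  inferInstanceAs (IsScalarTower ℂ ℂ⟦X⟧ (Λ → Fin (N + 1) → Fin p → ℂ⟦X⟧))

/-- The coordinates of `a (∑ f_{l,j,v} e_{l,j,v})`: the one at `(l,j,v)` is
`b² f_{l,j,v}' + l b f_{l,j,v} + (j+1) b f_{l,j+1,v}`, where `f_{l,N+1,v} = 0`. -/
def aFun (f : Λ → Fin (N + 1) → Fin p → ℂ⟦X⟧) : Λ → Fin (N + 1) → Fin p → ℂ⟦X⟧ :=
  fun l j v =>
    PowerSeries.X ^ 2 * PowerSeries.derivative ℂ (f l j v)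
      + PowerSeries.C ((l : ℚ) : ℂ) * (PowerSeries.X * f l j v)
      + if h : (j : ℕ) + 1 < N + 1 then
          PowerSeries.C ((j : ℂ) + 1) * (PowerSeries.X * f l ⟨j + 1, h⟩ v) else 0

instance : ABAction (Xi Λ N p) where
  a :=
    { toFun := aFun Λ N p
      map_add' := fun f g => by
        funext l j v
        change aFun Λ N p (fun l j v => f l j v + g l j v) l j v
          = aFun Λ N p f l j v + aFun Λ N p g l j v
        simp only [aFun, map_add]
        split_ifs <;> ring
      map_smul' := fun c f => by
        funext l j v
        change aFun Λ N p (fun l j v => c • f l j v) l j v = c • aFun Λ N p f l j v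
        simp only [aFun, Derivation.map_smul]
        simp only [PowerSeries.smul_eq_C_mul]
        split_ifs <;> ring }
  a_smul S f := by
    funext l j v
    change aFun Λ N p (fun l j v => S * f l j v) l j v
      = S * aFun Λ N p f l j v + (PowerSeries.X ^ 2 * PowerSeries.derivative ℂ S) * f l j v
    simp only [aFun, Derivation.leibniz, smul_eq_mul]
    split_ifs <;> ring

end Xi

section Main

variable (E : Type*) [AddCommGroup E] [Module ℂ E] [Module ℂ⟦X⟧ E] [IsScalarTower ℂ ℂ⟦X⟧ E]
  [ABAction E]

/-- `E` is a fresco: it is isomorphic to the submodule generated by one element `φ` of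
`Ξ_Λ^{(N)} ⊗ V`, for a finite subset `Λ` of `ℚ ∩ ]0,1]`, some `N`, and a finite dimensional complex
vector space `V` (which may be taken to be `ℂ^p`). -/
def IsFresco : Prop :=
  ∃ (Λ : Finset ℚ) (N p : ℕ) (φ : Xi Λ N p), (∀ l ∈ Λ, 0 < l ∧ l ≤ 1) ∧
    Nonempty (ABIso E (ABSub.gen φ).toSubmodule)

variable {E}

/-- `0 = F_0 ⊆ F_1 ⊆ ⋯ ⊆ F_k = E` is a Jordan–Hölder sequence: the `F_j` are normal submodules
and the quotients `F_j / F_{j-1}` have rank one. -/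
def IsJordanHolder {k : ℕ} (F : Fin (k + 1) → ABSub E) : Prop :=
  (F 0).toSubmodule = ⊥ ∧ (F (Fin.last k)).toSubmodule = ⊤ ∧
  (∀ j : Fin k, (F j.castSucc).toSubmodule ≤ (F j.succ).toSubmodule) ∧
  (∀ j, (F j).IsNormal) ∧
  ∀ j : Fin k, Module.finrank ℂ⟦X⟧ ((F j.succ).Quot (F j.castSucc)) = 1

/-- The complex numbers `μ_1, …, μ_k` are associated to the Jordan–Hölder sequence `F`:
`F_j / F_{j-1} ≃ E_{μ_j}`.  (Here `μ j`, for `j : Fin k`, stands for `μ_{j+1}`.) -/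
def IsJordanHolderWith {k : ℕ} (F : Fin (k + 1) → ABSub E) (μ : Fin k → ℂ) : Prop :=
  IsJordanHolder F ∧ ∀ j : Fin k, Nonempty (ABIso ((F j.succ).Quot (F j.castSucc)) (RankOne (μ j)))

end Main

/-- `μ` is a twisted permutation of `ν`: the sequence `μ_j + j` (`j = 1, …, k`) is a permutation of the
sequence `ν_j + j`. -/
def IsTwistedPermutation {k : ℕ} (ν μ : Fin k → ℂ) : Prop :=
  ∃ σ : Equiv.Perm (Fin k), ∀ j : Fin k,
    μ j + ((j : ℕ) + 1 : ℂ) = ν (σ j) + ((σ j : ℕ) + 1 : ℂ)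

end ABTheory

end

/-! Let `E` be generated by `φ`. A semi-simple `E` has finitely many morphisms `p i` to rank one
modules `E_{ρ i}` that together separate points. Write `m i` for the order of `p i φ` in `b`; the
numbers `ρ i + m i` govern everything.

The family can be chosen with pairwise distinct numbers (`IsDistinctFamily.exists_extend`): when two
numbers agree, subtracting leading terms produces a morphism with a larger number, and a maximality
argument ends the process.

For a distinct family, let `b T` be the factor by which `a` multiplies `p i φ`. Then `a - b T` kills
the component `i` of `φ` and, the numbers being distinct, raises the order of every other component
by exactly one; the resulting element generates `ker (p i)` (`EmbedsGen.interKer`). Peeling off all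
`k` components, in any chosen order, gives a Jordan–Hölder sequence with `μ_j + j = ρ_j + m_j + k`
(`IsDistinctFamily.isJordanHolderWith`). Every ordering of these values therefore occurs: the
decreasing one gives one half of (1), where the embedding in `Ξ` makes the values rational. For (2),
every Jordan–Hölder sequence must carry these same values; `EmbedsGen.exists_of_quot` shows this by
comparing orders.

For the other half of (1), morphisms to rank one modules are extended from `F_j` to `F_{j+1}` at the
cost of a factor `b`. The coefficients of the extension are found by dividing by `n + ρ - 1 - ν`,
which strict decrease keeps nonzero (`exists_extension_rankOneHom`). With the projection to each new
quotient, the extensions separate points. -/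

noncomputable section

namespace ABTheory

open ABAction (a)
open PowerSeries

/-! ### Orders of power series and the operator `a` on `E_μ` -/

section Series

/-- `S = X ^ m * U` with `U` invertible. -/
def HasOrd (m : ℕ) (S : ℂ⟦X⟧) : Prop := ∃ U : ℂ⟦X⟧, constantCoeff U ≠ 0 ∧ S = X ^ m * U

theorem HasOrd.coeff_ne_zero {m : ℕ} {S : ℂ⟦X⟧} (h : HasOrd m S) : coeff m S ≠ 0 := by
  obtain ⟨U, hU, rfl⟩ := h
  simpa [coeff_X_pow_mul'] using hU

theorem HasOrd.coeff_eq_zero {m n : ℕ} {S : ℂ⟦X⟧} (h : HasOrd m S) (hn : n < m) :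
    coeff n S = 0 := by
  obtain ⟨U, hU, rfl⟩ := h
  rw [coeff_X_pow_mul', if_neg (by omega)]

theorem HasOrd.ne_zero {m : ℕ} {S : ℂ⟦X⟧} (h : HasOrd m S) : S ≠ 0 := by
  rintro rfl
  exact h.coeff_ne_zero (map_zero _)

theorem HasOrd.mul {m n : ℕ} {S T : ℂ⟦X⟧} (hS : HasOrd m S) (hT : HasOrd n T) :
    HasOrd (m + n) (S * T) := by
  obtain ⟨U, hU, rfl⟩ := hS
  obtain ⟨V, hV, rfl⟩ := hT
  exact ⟨U * V, by simp [hU, hV], by ring⟩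

theorem hasOrd_X_pow (m : ℕ) : HasOrd m (X ^ m : ℂ⟦X⟧) := ⟨1, by simp, by simp⟩

theorem hasOrd_of_coeff {m : ℕ} {S : ℂ⟦X⟧} (h0 : ∀ n < m, coeff n S = 0) (h : coeff m S ≠ 0) :
    HasOrd m S := by
  obtain ⟨U, rfl⟩ := X_pow_dvd_iff.2 h0
  exact ⟨U, by simpa [coeff_X_pow_mul'] using h, rfl⟩

theorem exists_hasOrd {S : ℂ⟦X⟧} (h : S ≠ 0) : ∃ m, HasOrd m S := by
  have hex : ∃ n, coeff n S ≠ 0 := by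
    by_contra! hc
    exact h (PowerSeries.ext (by simpa using hc))
  classical
  exact ⟨Nat.find hex, hasOrd_of_coeff (fun n hn => not_not.1 (Nat.find_min hex hn))
    (Nat.find_spec hex)⟩

theorem HasOrd.exists_mul_eq {m : ℕ} {S : ℂ⟦X⟧} (h : HasOrd m S) :
    ∃ V : ℂ⟦X⟧, V * S = X ^ m := by
  obtain ⟨U, hU, rfl⟩ := h
  refine ⟨U⁻¹, ?_⟩
  rw [mul_left_comm, PowerSeries.inv_mul_cancel U hU, mul_one]

/-- Nonzero terms of pairwise distinct orders cannot cancel, so the order of the sum is the smallest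
of theirs. -/
theorem exists_hasOrd_of_sum {ι : Type*} {I : Finset ι} {f : ι → ℂ⟦X⟧} {o : ι → ℕ}
    (hf : ∀ i ∈ I, f i = 0 ∨ HasOrd (o i) (f i))
    (ho : ∀ i ∈ I, ∀ j ∈ I, f i ≠ 0 → f j ≠ 0 → o i = o j → i = j) {N : ℕ}
    (hN : HasOrd N (∑ i ∈ I, f i)) : ∃ i ∈ I, HasOrd N (f i) := by
  classical
  have hne : (I.filter fun i => f i ≠ 0).Nonempty := by
    by_contra hc
    rw [Finset.not_nonempty_iff_eq_empty, Finset.filter_eq_empty_iff] at hc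
    exact hN.ne_zero (Finset.sum_eq_zero fun i hi => not_not.1 (hc hi))
  obtain ⟨i, hi, hmin⟩ := Finset.exists_min_image _ o hne
  rw [Finset.mem_filter] at hi
  have hord : ∀ j ∈ I, f j ≠ 0 → HasOrd (o j) (f j) := fun j hj h => (hf j hj).resolve_left h
  have h0 : ∀ n < o i, coeff n (∑ i ∈ I, f i) = 0 := fun n hn => by
    rw [map_sum]
    refine Finset.sum_eq_zero fun j hj => ?_
    by_cases hj0 : f j = 0
    · rw [hj0, map_zero]
    · exact (hord j hj hj0).coeff_eq_zero (hn.trans_le (hmin j (Finset.mem_filter.2 ⟨hj, hj0⟩)))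
  have h1 : coeff (o i) (∑ i ∈ I, f i) ≠ 0 := by
    rw [map_sum, Finset.sum_eq_single_of_mem i hi.1]
    · exact (hord i hi.1 hi.2).coeff_ne_zero
    · intro j hj hji
      by_cases hj0 : f j = 0
      · rw [hj0, map_zero]
      · refine (hord j hj hj0).coeff_eq_zero (lt_of_le_of_ne
          (hmin j (Finset.mem_filter.2 ⟨hj, hj0⟩)) fun hc => hji ?_)
        exact (ho i hi.1 j hj hi.2 hj0 hc).symm
  have : N = o i := by
    rcases lt_trichotomy N (o i) with h | h | h
    · exact absurd (h0 N h) hN.coeff_ne_zero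
    · exact h
    · exact absurd (hN.coeff_eq_zero h) h1
  exact ⟨i, hi.1, this ▸ hord i hi.1 hi.2⟩

namespace RankOne

theorem aFun_apply (μ : ℂ) (S : ℂ⟦X⟧) :
    aFun μ S = X ^ 2 * PowerSeries.derivative ℂ S + C μ * (X * S) := by
  simp [aFun, PowerSeries.smul_eq_C_mul]

theorem coeff_zero_aFun (μ : ℂ) (S : ℂ⟦X⟧) : coeff 0 (aFun μ S) = 0 := by
  simp [aFun_apply]

theorem coeff_succ_aFun (μ : ℂ) (S : ℂ⟦X⟧) (n : ℕ) :
    coeff (n + 1) (aFun μ S) = ((n : ℂ) + μ) * coeff n S := by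
  rw [aFun_apply, map_add, pow_two, mul_assoc, coeff_succ_X_mul, coeff_C_mul, coeff_succ_X_mul]
  cases n with
  | zero => simp
  | succ n =>
    rw [coeff_succ_X_mul, coeff_derivative]
    push_cast
    ring

/-- The reason why `b ^ m E_μ` is a copy of `E_{μ + m}`. -/
theorem aFun_X_pow_mul (μ : ℂ) (m : ℕ) (S : ℂ⟦X⟧) :
    aFun μ (X ^ m * S) = X ^ m * aFun (μ + m) S := by
  ext n
  cases n with
  | zero =>
    rw [coeff_zero_aFun, coeff_X_pow_mul']
    split_ifs
    · rw [Nat.zero_sub, coeff_zero_aFun]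
    · rfl
  | succ n =>
    rw [coeff_succ_aFun, coeff_X_pow_mul', coeff_X_pow_mul']
    rcases lt_trichotomy m (n + 1) with h | h | h
    · obtain ⟨l, rfl⟩ := Nat.exists_eq_add_of_le (Nat.lt_succ_iff.1 h)
      rw [if_pos (by omega), if_pos (by omega), show m + l + 1 - m = l + 1 by omega,
        show m + l - m = l by omega, coeff_succ_aFun]
      push_cast
      ring
    · subst h
      simp [coeff_zero_aFun]
    · rw [if_neg (by omega), if_neg (by omega), mul_zero]

/-- Eigenvectors of `b⁻¹ a` in `E_μ` are monomials. -/
theorem eq_zero_or_hasOrd_of_aFun_eq {μ η : ℂ} {S : ℂ⟦X⟧} (h : aFun μ S = C η * (X * S)) :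
    S = 0 ∨ ∃ n : ℕ, HasOrd n S ∧ (n : ℂ) + μ = η := by
  by_cases hS : S = 0
  · exact Or.inl hS
  · obtain ⟨n, hn⟩ := exists_hasOrd hS
    refine Or.inr ⟨n, hn, ?_⟩
    have := congrArg (coeff (n + 1)) h
    rw [coeff_succ_aFun, coeff_C_mul, coeff_succ_X_mul] at this
    exact mul_right_cancel₀ hn.coeff_ne_zero this

end RankOne

/-- Logarithmic derivative: for `S = X ^ m * U` one takes `T = μ + m + X U' / U`. -/
theorem HasOrd.exists_aFun_eq (μ : ℂ) {m : ℕ} {S : ℂ⟦X⟧} (h : HasOrd m S) :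
    ∃ T : ℂ⟦X⟧, constantCoeff T = μ + m ∧ RankOne.aFun μ S = X * T * S := by
  obtain ⟨U, hU, rfl⟩ := h
  refine ⟨C (μ + m) + X * PowerSeries.derivative ℂ U * U⁻¹, by simp, ?_⟩
  rw [RankOne.aFun_X_pow_mul, RankOne.aFun_apply]
  linear_combination (-X ^ m * X ^ 2 * PowerSeries.derivative ℂ U) * PowerSeries.inv_mul_cancel U hU

/-- Only the value `μ + m` of `T` at `0` cancels the leading term; for any other value `a - b T`
raises the order by exactly one. -/
theorem HasOrd.aFun_sub {μ : ℂ} {m : ℕ} {S T : ℂ⟦X⟧} (h : HasOrd m S)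
    (hT : constantCoeff T ≠ μ + m) : HasOrd (m + 1) (RankOne.aFun μ S - X * T * S) := by
  obtain ⟨T', hT', hS⟩ := h.exists_aFun_eq μ
  obtain ⟨U, hU, rfl⟩ := h
  refine ⟨(T' - T) * U, ?_, ?_⟩
  · rw [map_mul, map_sub, hT']
    exact mul_ne_zero (sub_ne_zero.2 hT.symm) hU
  · rw [hS]
    ring

/-- The solution is `exp (∫ g)`, an integrating factor that later normalizes generators of rank one
modules. -/
theorem exists_derivative_eq_mul (g : ℂ⟦X⟧) :
    ∃ V : ℂ⟦X⟧, constantCoeff V ≠ 0 ∧ PowerSeries.derivative ℂ V = g * V := by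
  let G : ℂ⟦X⟧ := X * PowerSeries.mk fun n => coeff n g / ((n : ℂ) + 1)
  have hG : HasSubst G := HasSubst.of_constantCoeff_zero' (by simp [G])
  have hd : PowerSeries.derivative ℂ G = g := by
    ext n
    rw [coeff_derivative, coeff_succ_X_mul, coeff_mk, div_mul_cancel₀ _ (Nat.cast_add_one_ne_zero n)]
  refine ⟨(exp ℂ).subst G, ?_, ?_⟩
  · have := (isUnit_exp ℂ).map (substAlgHom (R := ℂ) hG)
    rw [coe_substAlgHom, isUnit_iff_constantCoeff] at this
    exact this.ne_zero
  · rw [derivative_subst hG, derivative_exp, hd, mul_comm]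

end Series

/-! ### Cyclic submodules and morphisms to rank one modules -/

section RankOneHom

variable {E : Type*} [AddCommGroup E] [Module ℂ E] [Module ℂ⟦X⟧ E] [IsScalarTower ℂ ℂ⟦X⟧ E]
  [ABAction E]

theorem a_X_mul_smul (μ : ℂ) (S : ℂ⟦X⟧) {x : E} (hx : a x = (C μ * X) • x) :
    a (S • x) = RankOne.aFun μ S • x := by
  rw [ABAction.a_smul, hx, smul_smul, ← add_smul, RankOne.aFun_apply]
  congr 1
  ring

/-- `p`, read as a map `E → E_μ`, is a morphism. -/
def IsRankOneHom (μ : ℂ) (p : E →ₗ[ℂ⟦X⟧] ℂ⟦X⟧) : Prop :=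
  ∀ x, p (a x) = RankOne.aFun μ (p x)

theorem IsRankOneHom.sub {μ : ℂ} {p q : E →ₗ[ℂ⟦X⟧] ℂ⟦X⟧} (hp : IsRankOneHom μ p)
    (hq : IsRankOneHom μ q) : IsRankOneHom μ (p - q) := fun x => by
  rw [LinearMap.sub_apply, LinearMap.sub_apply, hp, hq, map_sub]

theorem IsRankOneHom.C_smul {μ : ℂ} {p : E →ₗ[ℂ⟦X⟧] ℂ⟦X⟧} (hp : IsRankOneHom μ p) (c : ℂ) :
    IsRankOneHom μ (C c • p) := fun x => by
  rw [LinearMap.smul_apply, LinearMap.smul_apply, hp, smul_eq_mul, smul_eq_mul,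
    ← PowerSeries.smul_eq_C_mul, ← PowerSeries.smul_eq_C_mul, map_smul]

theorem IsRankOneHom.X_pow_smul {μ : ℂ} {p : E →ₗ[ℂ⟦X⟧] ℂ⟦X⟧} (hp : IsRankOneHom μ p) (n : ℕ) :
    IsRankOneHom (μ - n) ((X ^ n : ℂ⟦X⟧) • p) := fun x => by
  rw [LinearMap.smul_apply, LinearMap.smul_apply, hp, smul_eq_mul, smul_eq_mul,
    RankOne.aFun_X_pow_mul, sub_add_cancel]

theorem IsRankOneHom.apply_a_sub {μ : ℂ} {p : E →ₗ[ℂ⟦X⟧] ℂ⟦X⟧} (hp : IsRankOneHom μ p)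
    (T : ℂ⟦X⟧) (x : E) : p (a x - (X * T) • x) = RankOne.aFun μ (p x) - X * T * p x := by
  rw [map_sub, hp, map_smul, smul_eq_mul]

theorem ABSub.mem_gen (x : E) : x ∈ (ABSub.gen x).toSubmodule := by
  change x ∈ sInf {G : Submodule ℂ⟦X⟧ E | x ∈ G ∧ ∀ y ∈ G, a y ∈ G}
  exact Submodule.mem_sInf.2 fun G hG => hG.1

theorem ABSub.gen_le {x : E} {G : Submodule ℂ⟦X⟧ E} (hx : x ∈ G) (ha : ∀ y ∈ G, a y ∈ G) :
    (ABSub.gen x).toSubmodule ≤ G := by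
  change sInf {G : Submodule ℂ⟦X⟧ E | x ∈ G ∧ ∀ y ∈ G, a y ∈ G} ≤ G
  exact sInf_le ⟨hx, ha⟩

theorem ABSub.a_sub_smul_mem (G : ABSub E) (S : ℂ⟦X⟧) {x : E} (hx : x ∈ G.toSubmodule) :
    a x - S • x ∈ G.toSubmodule :=
  sub_mem (G.a_mem x hx) (G.toSubmodule.smul_mem S hx)

/-- Division by `a - b T`: the submodule generated by `x` is `ℂ⟦b⟧ x` plus the one generated by
`(a - b T) x`. -/
theorem ABSub.gen_le_span_sup (x : E) (S : ℂ⟦X⟧) :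
    (ABSub.gen x).toSubmodule ≤ (ℂ⟦X⟧ ∙ x) ⊔ (ABSub.gen (a x - S • x)).toSubmodule := by
  refine ABSub.gen_le (Submodule.mem_sup_left (Submodule.mem_span_singleton_self x)) ?_
  intro y hy
  obtain ⟨u, hu, g, hg, rfl⟩ := Submodule.mem_sup.1 hy
  obtain ⟨R, rfl⟩ := Submodule.mem_span_singleton.1 hu
  rw [map_add]
  refine add_mem ?_ (Submodule.mem_sup_right ((ABSub.gen _).a_mem g hg))
  have : a (R • x) = (R * S + X ^ 2 * PowerSeries.derivative ℂ R) • x + R • (a x - S • x) := by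
    rw [ABAction.a_smul, add_smul, smul_sub, mul_smul R S]
    abel
  rw [this]
  exact add_mem (Submodule.mem_sup_left (Submodule.smul_mem _ _ (Submodule.mem_span_singleton_self x)))
    (Submodule.mem_sup_right (Submodule.smul_mem _ _ (ABSub.mem_gen _)))

/-- An element of `G` is `R x + g` with `g` in the module generated by `(a - S) x`, which lies in
`G`. Hence `R x` is in `G`, and `R = 0`. -/
theorem ABSub.eq_gen_a_sub {G H : ABSub E} {x : E} {S : ℂ⟦X⟧}
    (hH : H.toSubmodule = (ABSub.gen x).toSubmodule) (hle : G.toSubmodule ≤ H.toSubmodule)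
    (hx : a x - S • x ∈ G.toSubmodule) (h0 : ∀ R : ℂ⟦X⟧, R • x ∈ G.toSubmodule → R = 0) :
    G.toSubmodule = (ABSub.gen (a x - S • x)).toSubmodule := by
  have hge : (ABSub.gen (a x - S • x)).toSubmodule ≤ G.toSubmodule := ABSub.gen_le hx G.a_mem
  refine le_antisymm (fun y hy => ?_) hge
  obtain ⟨u, hu, g, hg, rfl⟩ := Submodule.mem_sup.1 (ABSub.gen_le_span_sup x S (hH ▸ hle hy))
  obtain ⟨R, rfl⟩ := Submodule.mem_span_singleton.1 hu
  have hR : R • x ∈ G.toSubmodule := by simpa using sub_mem hy (hge hg)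
  rw [h0 R hR, zero_smul, zero_add]
  exact hg

/-- A morphism to a rank one module maps the submodule generated by `x` into `X ^ m ℂ⟦X⟧` as soon as
it maps `x` there. -/
theorem IsRankOneHom.dvd_of_mem_gen {μ : ℂ} {p : E →ₗ[ℂ⟦X⟧] ℂ⟦X⟧} (hp : IsRankOneHom μ p)
    {x y : E} {m : ℕ} (hx : (X ^ m : ℂ⟦X⟧) ∣ p x) (hy : y ∈ (ABSub.gen x).toSubmodule) :
    (X ^ m : ℂ⟦X⟧) ∣ p y := by
  have := ABSub.gen_le (x := x) (G := Submodule.comap p (Ideal.span {(X ^ m : ℂ⟦X⟧)}))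
    (by simpa [Ideal.mem_span_singleton] using hx) (fun z hz => by
      rw [Submodule.mem_comap, Ideal.mem_span_singleton] at hz ⊢
      obtain ⟨R, hR⟩ := hz
      rw [hp, hR, RankOne.aFun_X_pow_mul]
      exact dvd_mul_right _ _) hy
  simpa [Ideal.mem_span_singleton] using this

theorem IsRankOneHom.eq_zero_of_mem_gen {μ : ℂ} {p : E →ₗ[ℂ⟦X⟧] ℂ⟦X⟧} (hp : IsRankOneHom μ p)
    {x y : E} (hx : p x = 0) (hy : y ∈ (ABSub.gen x).toSubmodule) : p y = 0 :=
  ABSub.gen_le (x := x) (G := LinearMap.ker p) hx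
    (fun z hz => by rw [LinearMap.mem_ker] at hz ⊢; rw [hp, hz, map_zero]) hy

/-- The kernel in `G` of a morphism to a rank one module. -/
def ABSub.interKer (G : ABSub E) {μ : ℂ} {p : E →ₗ[ℂ⟦X⟧] ℂ⟦X⟧} (hp : IsRankOneHom μ p) : ABSub E where
  toSubmodule := G.toSubmodule ⊓ LinearMap.ker p
  a_mem x hx := ⟨G.a_mem x hx.1, by
    have h : p x = 0 := hx.2
    change p (a x) = 0
    rw [hp, h, map_zero]⟩

/-- The projection to a rank one quotient. -/
theorem exists_rankOneHom_of_quot {G H : ABSub E} {ν : ℂ}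
    (h : Nonempty (ABIso (H.Quot G) (RankOne ν))) :
    ∃ π : H.toSubmodule →ₗ[ℂ⟦X⟧] ℂ⟦X⟧, IsRankOneHom ν π ∧ Function.Surjective π ∧
      ∀ x, π x = 0 ↔ (x : E) ∈ G.toSubmodule := by
  obtain ⟨e⟩ := h
  let e' : H.Quot G →ₗ[ℂ⟦X⟧] ℂ⟦X⟧ := e.toLinearEquiv.toLinearMap
  refine ⟨e' ∘ₗ (G.inside H).toSubmodule.mkQ, fun x => e.map_a ((G.inside H).toSubmodule.mkQ x), ?_, fun x => ?_⟩
  · exact e.toLinearEquiv.surjective.comp (Submodule.mkQ_surjective _)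
  · change e.toLinearEquiv _ = 0 ↔ _
    rw [LinearEquiv.map_eq_zero_iff]
    exact Submodule.Quotient.mk_eq_zero _

/-- The image of `H` under `π` is exactly `b ^ M E_ρ`, whose generator `X ^ M` satisfies the
relation of `E_{ρ + M}`. -/
theorem nonempty_abIso_rankOne {G H : ABSub E} {ρ : ℂ} {M : ℕ}
    {π : E →ₗ[ℂ⟦X⟧] ℂ⟦X⟧} (hπ : IsRankOneHom ρ π)
    (hker : ∀ x ∈ H.toSubmodule, π x = 0 ↔ x ∈ G.toSubmodule)
    (hdvd : ∀ x ∈ H.toSubmodule, X ^ M ∣ π x) {y : E} (hy : y ∈ H.toSubmodule) (hyM : π y = X ^ M) :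
    Nonempty (ABIso (H.Quot G) (RankOne (ρ + M))) := by
  let q := (G.inside H).toSubmodule.mkQ
  let f : RankOne (ρ + M) →ₗ[ℂ⟦X⟧] H.Quot G :=
    LinearMap.toSpanSingleton ℂ⟦X⟧ _ (q ⟨y, hy⟩)
  have hq0 : ∀ x : H.toSubmodule, q x = 0 ↔ π x = 0 := fun x => by
    rw [hker x.1 x.2]
    exact Submodule.Quotient.mk_eq_zero _
  have hfq : ∀ S : ℂ⟦X⟧, f S = q (S • ⟨y, hy⟩) := fun S => by
    rw [map_smul]
    rfl
  have hinj : Function.Injective f := by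
    rw [injective_iff_map_eq_zero]
    intro (S : ℂ⟦X⟧) hS
    rw [hfq, hq0] at hS
    change π (S • y) = 0 at hS
    rw [map_smul, hyM, smul_eq_mul] at hS
    exact (mul_eq_zero.1 hS).resolve_right (pow_ne_zero _ X_ne_zero)
  have hsurj : Function.Surjective f := by
    intro z
    obtain ⟨x, rfl⟩ := (G.inside H).toSubmodule.mkQ_surjective z
    obtain ⟨S, hS⟩ := hdvd x.1 x.2
    refine ⟨S, ?_⟩
    rw [hfq]
    change q _ = q x
    rw [← sub_eq_zero, ← map_sub, hq0]
    change π (S • y - x.1) = 0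
    rw [map_sub, map_smul, hyM, hS, smul_eq_mul, mul_comm, sub_self]
  have hy_a : a (q ⟨y, hy⟩) = (C (ρ + M) * X) • q ⟨y, hy⟩ := by
    change q (a ⟨y, hy⟩) = _
    rw [← map_smul, ← sub_eq_zero, ← map_sub, hq0]
    change π (a y - (C (ρ + M) * X) • y) = 0
    rw [map_sub, map_smul, hπ, hyM, smul_eq_mul]
    have := RankOne.aFun_X_pow_mul ρ M 1
    rw [mul_one] at this
    rw [this, RankOne.aFun_apply]
    simp
    ring
  let e := LinearEquiv.ofBijective f ⟨hinj, hsurj⟩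
  have he : ∀ S : RankOne (ρ + M), e (a S) = a (e S) := fun S =>
    (a_X_mul_smul (ρ + M) S hy_a).symm
  exact ⟨{ e.symm with
    map_a := fun x => by
      change e.symm (a x) = a (e.symm x)
      rw [LinearEquiv.symm_apply_eq, he, LinearEquiv.apply_symm_apply] }⟩

theorem finrank_eq_one_of_abIso {G H : ABSub E} {ν : ℂ}
    (h : Nonempty (ABIso (H.Quot G) (RankOne ν))) :
    Module.finrank ℂ⟦X⟧ (H.Quot G) = 1 := by
  obtain ⟨e⟩ := h
  let e' : H.Quot G ≃ₗ[ℂ⟦X⟧] ℂ⟦X⟧ := e.toLinearEquiv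
  rw [e'.finrank_eq, Module.finrank_self]

end RankOneHom

/-! ### Peeling off one component of an embedded cyclic module -/

section Family

variable {E : Type*} [AddCommGroup E] [Module ℂ E] [Module ℂ⟦X⟧ E] [IsScalarTower ℂ ℂ⟦X⟧ E]
  [ABAction E] {ι : Type*}

/-- The morphisms `p i`, `i ∈ I`, embed `G`, which is generated by `ψ`, in a sum of rank one modules,
and the component `p i ψ` has order `m i + d`. -/
structure EmbedsGen (p : ι → E →ₗ[ℂ⟦X⟧] ℂ⟦X⟧) (m : ι → ℕ) (G : ABSub E) (ψ : E) (I : Finset ι)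
    (d : ℕ) : Prop where
  eq_gen : G.toSubmodule = (ABSub.gen ψ).toSubmodule
  ord : ∀ i ∈ I, HasOrd (m i + d) (p i ψ)
  inj : ∀ x ∈ G.toSubmodule, (∀ i ∈ I, p i x = 0) → x = 0

variable {p : ι → E →ₗ[ℂ⟦X⟧] ℂ⟦X⟧} {ρ : ι → ℂ} {m : ι → ℕ}

theorem EmbedsGen.mem {G : ABSub E} {ψ : E} {I : Finset ι} {d : ℕ} (h : EmbedsGen p m G ψ I d) :
    ψ ∈ G.toSubmodule := h.eq_gen ▸ ABSub.mem_gen ψ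

/-- The rank one quotient `G / (G ∩ ker p_i)`. -/
theorem EmbedsGen.nonempty_abIso (hp : ∀ i, IsRankOneHom (ρ i) (p i)) {G G' : ABSub E} {ψ : E}
    {I : Finset ι} {d : ℕ} (h : EmbedsGen p m G ψ I d) {i : ι} (hi : i ∈ I)
    (hG' : ∀ x ∈ G.toSubmodule, p i x = 0 ↔ x ∈ G'.toSubmodule) :
    Nonempty (ABIso (G.Quot G') (RankOne (ρ i + (m i + d : ℕ)))) := by
  obtain ⟨V, hV⟩ := (h.ord i hi).exists_mul_eq
  refine nonempty_abIso_rankOne (hp i) hG' (fun x hx => ?_) (y := V • ψ)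
    (G.toSubmodule.smul_mem _ h.mem) (by rw [map_smul, smul_eq_mul, hV])
  refine (hp i).dvd_of_mem_gen ?_ (h.eq_gen ▸ hx)
  obtain ⟨U, -, hU⟩ := h.ord i hi
  exact ⟨U, hU⟩

variable [DecidableEq ι]

/-- The inductive step shared by existence and uniqueness: `T` has the critical value of the
component `i`, so by injectivity of `ρ + m` it misses that of every other component, whose order
grows by exactly one. -/
theorem EmbedsGen.erase (hp : ∀ i, IsRankOneHom (ρ i) (p i))
    (hr : Function.Injective fun i => ρ i + m i) {G G' : ABSub E} {ψ : E} {I : Finset ι} {d : ℕ}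
    (h : EmbedsGen p m G ψ I d) {i : ι} {T : ℂ⟦X⟧}
    (hT : constantCoeff T = ρ i + m i + d) (hle : G'.toSubmodule ≤ G.toSubmodule)
    (hψ : a ψ - (X * T) • ψ ∈ G'.toSubmodule) (h0 : ∀ R : ℂ⟦X⟧, R • ψ ∈ G'.toSubmodule → R = 0)
    (hinj : ∀ x ∈ G'.toSubmodule, (∀ j ∈ I.erase i, p j x = 0) → x = 0) :
    EmbedsGen p m G' (a ψ - (X * T) • ψ) (I.erase i) (d + 1) where
  eq_gen := ABSub.eq_gen_a_sub h.eq_gen hle hψ h0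
  ord j hj := by
    rw [(hp j).apply_a_sub, ← add_assoc]
    refine (h.ord j (Finset.mem_of_mem_erase hj)).aFun_sub fun hc => ?_
    refine (Finset.ne_of_mem_erase hj) (hr ?_)
    rw [hT] at hc
    push_cast at hc
    linear_combination -hc
  inj := hinj

/-- Taking for `b T` the factor by which `a` multiplies `p i ψ` puts `(a - b T) ψ` in the kernel. -/
theorem EmbedsGen.interKer (hp : ∀ i, IsRankOneHom (ρ i) (p i))
    (hr : Function.Injective fun i => ρ i + m i) {G : ABSub E} {ψ : E} {I : Finset ι} {d : ℕ}
    (h : EmbedsGen p m G ψ I d) {i : ι} (hi : i ∈ I) :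
    ∃ ψ', EmbedsGen p m (G.interKer (hp i)) ψ' (I.erase i) (d + 1) := by
  obtain ⟨T, hT, hS⟩ := (h.ord i hi).exists_aFun_eq (ρ i)
  refine ⟨_, h.erase hp hr (i := i) (T := T) (by rw [hT]; push_cast; ring) inf_le_left
    ⟨G.a_sub_smul_mem _ h.mem, ?_⟩ ?_ ?_⟩
  · change p i _ = 0
    rw [(hp i).apply_a_sub, hS, sub_self]
  · intro R hR
    have h0 : p i (R • ψ) = 0 := hR.2
    rw [map_smul, smul_eq_mul] at h0
    exact (mul_eq_zero.1 h0).resolve_right (h.ord i hi).ne_zero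
  · intro x hx hj
    refine h.inj x hx.1 fun j hjI => ?_
    by_cases hji : j = i
    · subst hji
      exact hx.2
    · exact hj j (Finset.mem_erase.2 ⟨hji, hjI⟩)

end Family

/-! ### From a distinct family to a Jordan–Hölder sequence -/

section JordanHolder

variable {E : Type*} [AddCommGroup E] [Module ℂ E] [Module ℂ⟦X⟧ E] [IsScalarTower ℂ ℂ⟦X⟧ E]
  [ABAction E] {ι : Type*}

/-- Morphisms `p i` from `E` to the rank one modules `E_{ρ i}` that map the generator `φ` to elements
of order `m i`, with pairwise distinct `ρ i + m i`. -/
structure IsDistinctFamily (φ : E) (p : ι → E →ₗ[ℂ⟦X⟧] ℂ⟦X⟧) (ρ : ι → ℂ) (m : ι → ℕ) : Prop where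
  hom : ∀ i, IsRankOneHom (ρ i) (p i)
  ord : ∀ i, HasOrd (m i) (p i φ)
  injective : Function.Injective fun i => ρ i + m i

variable {φ : E} {p : ι → E →ₗ[ℂ⟦X⟧] ℂ⟦X⟧} {ρ : ι → ℂ} {m : ι → ℕ}

theorem EmbedsGen.congr {G G' : ABSub E} {ψ : E} {I : Finset ι} {d : ℕ}
    (h : EmbedsGen p m G ψ I d) (hG : G.toSubmodule = G'.toSubmodule) :
    EmbedsGen p m G' ψ I d :=
  ⟨hG ▸ h.eq_gen, h.ord, hG ▸ h.inj⟩

theorem IsDistinctFamily.embedsGen [Fintype ι] (h : IsDistinctFamily φ p ρ m)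
    (hφ : (ABSub.gen φ).toSubmodule = ⊤) (hinj : ∀ x, (∀ i, p i x = 0) → x = 0) {G : ABSub E}
    (hG : G.toSubmodule = ⊤) : EmbedsGen p m G φ Finset.univ 0 where
  eq_gen := hG.trans hφ.symm
  ord i _ := h.ord i
  inj x _ hx := hinj x fun i => hx i (Finset.mem_univ i)

/-- The filtration by the common kernels of the `p i`, `j ≤ i`. -/
def kerFiltration {k : ℕ} {p : Fin k → E →ₗ[ℂ⟦X⟧] ℂ⟦X⟧} {ρ : Fin k → ℂ}
    (hp : ∀ i, IsRankOneHom (ρ i) (p i)) (j : Fin (k + 1)) : ABSub E where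
  toSubmodule := ⨅ i : Fin k, ⨅ _ : j ≤ i.castSucc, LinearMap.ker (p i)
  a_mem x hx := by
    change x ∈ ⨅ i : Fin k, ⨅ _ : j ≤ i.castSucc, LinearMap.ker (p i) at hx
    change a x ∈ ⨅ i : Fin k, ⨅ _ : j ≤ i.castSucc, LinearMap.ker (p i)
    simp only [Submodule.mem_iInf, LinearMap.mem_ker] at hx ⊢
    intro i hi
    rw [hp i, hx i hi, map_zero]

theorem mem_kerFiltration {k : ℕ} {p : Fin k → E →ₗ[ℂ⟦X⟧] ℂ⟦X⟧} {ρ : Fin k → ℂ}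
    (hp : ∀ i, IsRankOneHom (ρ i) (p i)) (j : Fin (k + 1)) (x : E) :
    x ∈ (kerFiltration hp j).toSubmodule ↔ ∀ i : Fin k, j ≤ i.castSucc → p i x = 0 := by
  change x ∈ ⨅ i : Fin k, ⨅ _ : j ≤ i.castSucc, LinearMap.ker (p i) ↔ _
  simp only [Submodule.mem_iInf, LinearMap.mem_ker]

theorem mem_kerFiltration_castSucc {k : ℕ} {p : Fin k → E →ₗ[ℂ⟦X⟧] ℂ⟦X⟧} {ρ : Fin k → ℂ}
    (hp : ∀ i, IsRankOneHom (ρ i) (p i)) (j : Fin k) (x : E) :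
    x ∈ (kerFiltration hp j.castSucc).toSubmodule ↔
      x ∈ (kerFiltration hp j.succ).toSubmodule ∧ p j x = 0 := by
  rw [mem_kerFiltration, mem_kerFiltration]
  refine ⟨fun h => ⟨fun i hi => h i (j.castSucc_lt_succ.le.trans hi), h j le_rfl⟩,
    fun h i hi => ?_⟩
  rcases eq_or_lt_of_le hi with hij | hij
  · exact Fin.castSucc_injective k hij ▸ h.2
  · exact h.1 i (Fin.succ_le_castSucc_iff.2 (Fin.castSucc_lt_castSucc_iff.1 hij))

theorem kerFiltration_last {k : ℕ} {p : Fin k → E →ₗ[ℂ⟦X⟧] ℂ⟦X⟧} {ρ : Fin k → ℂ}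
    (hp : ∀ i, IsRankOneHom (ρ i) (p i)) : (kerFiltration hp (Fin.last k)).toSubmodule = ⊤ := by
  rw [eq_top_iff]
  intro x _
  rw [mem_kerFiltration]
  intro i hi
  exact absurd hi (not_le.2 i.castSucc_lt_last)

/-- Descending from `E`, step `j` has removed `k - j` components, so the orders have grown by `k -
j`. -/
theorem IsDistinctFamily.embedsGen_kerFiltration {k : ℕ} {p : Fin k → E →ₗ[ℂ⟦X⟧] ℂ⟦X⟧}
    {ρ : Fin k → ℂ} {m : Fin k → ℕ} (h : IsDistinctFamily φ p ρ m)
    (hφ : (ABSub.gen φ).toSubmodule = ⊤) (hinj : ∀ x, (∀ i, p i x = 0) → x = 0)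
    (j : Fin (k + 1)) :
    ∃ ψ, EmbedsGen p m (kerFiltration h.hom j) ψ (Finset.univ.filter fun i => i.castSucc < j)
      (k - j) := by
  induction j using Fin.reverseInduction with
  | last =>
    refine ⟨φ, ?_⟩
    have := h.embedsGen hφ hinj (kerFiltration_last h.hom)
    simpa [Fin.castSucc_lt_last] using this
  | cast j ih =>
    obtain ⟨ψ, hψ⟩ := ih
    obtain ⟨ψ', hψ'⟩ := hψ.interKer h.hom h.injective (i := j)
      (by simp)
    refine ⟨ψ', ?_⟩
    have hI : (Finset.univ.filter fun i : Fin k => i.castSucc < j.succ).erase j =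
        Finset.univ.filter fun i : Fin k => i.castSucc < j.castSucc := by
      ext i
      simp only [Finset.mem_erase, Finset.mem_filter, Finset.mem_univ, true_and, Fin.lt_def,
        Fin.val_castSucc, Fin.val_succ, ne_eq, Fin.ext_iff]
      omega
    have hd : k - (j.succ : ℕ) + 1 = k - (j.castSucc : ℕ) := by
      have := j.2
      simp only [Fin.val_castSucc, Fin.val_succ]
      omega
    rw [hI, hd] at hψ'
    exact hψ'.congr (Submodule.ext fun x => (mem_kerFiltration_castSucc h.hom j x).symm)

/-- A distinct family that embeds `E` gives a Jordan–Hölder sequence. -/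
theorem IsDistinctFamily.isJordanHolderWith {k : ℕ} {p : Fin k → E →ₗ[ℂ⟦X⟧] ℂ⟦X⟧}
    {ρ : Fin k → ℂ} {m : Fin k → ℕ} (h : IsDistinctFamily φ p ρ m)
    (hφ : (ABSub.gen φ).toSubmodule = ⊤) (hinj : ∀ x, (∀ i, p i x = 0) → x = 0)
    {μ : Fin k → ℂ} (hμ : ∀ j : Fin k, μ j + ((j : ℕ) + 1 : ℂ) = ρ j + m j + k) :
    IsJordanHolderWith (kerFiltration h.hom) μ := by
  have hiso : ∀ j : Fin k, Nonempty (ABIso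
      ((kerFiltration h.hom j.succ).Quot (kerFiltration h.hom j.castSucc)) (RankOne (μ j))) := by
    intro j
    obtain ⟨ψ, hψ⟩ := h.embedsGen_kerFiltration hφ hinj j.succ
    have := hψ.nonempty_abIso h.hom (i := j) (G' := kerFiltration h.hom j.castSucc)
      (by simp) fun x hx => by
        rw [mem_kerFiltration_castSucc]
        exact ⟨fun h => ⟨hx, h⟩, fun h => h.2⟩
    have hj : (j.succ : ℕ) ≤ k := j.2
    -- The quotient is read in `F_{j+1}`, from which only `k - (j + 1)` components have been
    -- removed.
    have hμj : μ j = ρ j + (m j + (k - (j.succ : ℕ)) : ℕ) := by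
      rw [Nat.cast_add, Nat.cast_sub hj, Fin.val_succ]
      push_cast
      linear_combination hμ j
    rw [hμj]
    exact this
  refine ⟨⟨?_, kerFiltration_last h.hom, fun j x hx => ?_, fun j x => ⟨?_, ?_⟩,
    fun j => finrank_eq_one_of_abIso (hiso j)⟩, hiso⟩
  · rw [eq_bot_iff]
    intro x hx
    rw [mem_kerFiltration] at hx
    exact hinj x fun i => hx i (Fin.zero_le _)
  · exact ((mem_kerFiltration_castSucc h.hom j x).1 hx).1
  · rintro ⟨hx, y, rfl⟩
    refine ⟨y, ?_, rfl⟩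
    rw [mem_kerFiltration] at hx ⊢
    intro i hi
    have := hx i hi
    rw [map_smul, smul_eq_mul] at this
    exact (mul_eq_zero.1 this).resolve_left X_ne_zero
  · rintro ⟨z, hz, rfl⟩
    exact ⟨Submodule.smul_mem _ _ hz, z, rfl⟩

end JordanHolder

/-! ### The numbers of an arbitrary Jordan–Hölder sequence -/

section Uniqueness

variable {E : Type*} [AddCommGroup E] [Module ℂ E] [Module ℂ⟦X⟧ E] [IsScalarTower ℂ ℂ⟦X⟧ E]
  [ABAction E] {ι : Type*} [DecidableEq ι]
variable {φ : E} {p : ι → E →ₗ[ℂ⟦X⟧] ℂ⟦X⟧} {ρ : ι → ℂ} {m : ι → ℕ}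

/-- Peel off all components but `i`: the generator that remains sees only `p i`. -/
theorem EmbedsGen.exists_hasOrd (hp : ∀ i, IsRankOneHom (ρ i) (p i))
    (hr : Function.Injective fun i => ρ i + m i) {G : ABSub E} {ψ : E} {I : Finset ι} {d : ℕ}
    (h : EmbedsGen p m G ψ I d) {i : ι} (hi : i ∈ I) :
    ∃ M, ∃ x ∈ G.toSubmodule, HasOrd M (p i x) ∧ ∀ j ∈ I, j ≠ i → p j x = 0 := by
  induction hn : I.card generalizing I G ψ d with
  | zero =>
    rw [Finset.card_eq_zero] at hn
    simp [hn] at hi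
  | succ n ih =>
    by_cases hI : ∃ j ∈ I, j ≠ i
    · obtain ⟨j, hj, hji⟩ := hI
      obtain ⟨ψ', hψ'⟩ := h.interKer hp hr hj
      obtain ⟨M, x, hx, hM, hx0⟩ := ih hψ' (Finset.mem_erase.2 ⟨hji.symm, hi⟩)
        (by rw [Finset.card_erase_of_mem hj, hn, Nat.add_sub_cancel])
      refine ⟨M, x, hx.1, hM, fun l hl hli => ?_⟩
      by_cases hlj : l = j
      · subst hlj
        exact hx.2
      · exact hx0 l (Finset.mem_erase.2 ⟨hlj, hl⟩) hli
    · push Not at hI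
      exact ⟨_, ψ, h.mem, h.ord i hi, fun j hj hji => absurd (hI j hj) hji⟩

/-- A dual basis up to the denominator `X ^ N`. Its members are eigenvectors of `b⁻¹a`, because this
can be tested on the components. -/
theorem EmbedsGen.exists_dual (hp : ∀ i, IsRankOneHom (ρ i) (p i))
    (hr : Function.Injective fun i => ρ i + m i) {G : ABSub E} {ψ : E} {I : Finset ι} {d : ℕ}
    (h : EmbedsGen p m G ψ I d) :
    ∃ (N : ℕ) (x : ι → E), ∀ i ∈ I, x i ∈ G.toSubmodule ∧ p i (x i) = X ^ N ∧
      (∀ j ∈ I, j ≠ i → p j (x i) = 0) ∧ a (x i) = (C (ρ i + N) * X) • x i := by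
  have hex : ∀ i, ∃ (M : ℕ) (x : E), i ∈ I → x ∈ G.toSubmodule ∧ HasOrd M (p i x) ∧
      ∀ j ∈ I, j ≠ i → p j x = 0 := fun i => by
    by_cases hi : i ∈ I
    · obtain ⟨M, x, hx, hM, h0⟩ := h.exists_hasOrd hp hr hi
      exact ⟨M, x, fun _ => ⟨hx, hM, h0⟩⟩
    · exact ⟨0, 0, fun h => absurd h hi⟩
  choose M x hx using hex
  have hV : ∀ i, ∃ V : ℂ⟦X⟧, i ∈ I → V * p i (x i) = X ^ M i := fun i => by
    by_cases hi : i ∈ I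
    · obtain ⟨V, hV⟩ := (hx i hi).2.1.exists_mul_eq
      exact ⟨V, fun _ => hV⟩
    · exact ⟨0, fun h => absurd h hi⟩
  choose V hV using hV
  -- The power of `X` taken from the other indices brings all components to the common order `N = ∑
  -- M i`.
  refine ⟨∑ i ∈ I, M i, fun i => (X ^ (∑ j ∈ I.erase i, M j) * V i) • x i, fun i hi => ?_⟩
  have h1 : p i ((X ^ (∑ j ∈ I.erase i, M j) * V i) • x i) = X ^ (∑ i ∈ I, M i) := by
    rw [map_smul, smul_eq_mul, mul_assoc, hV i hi, ← pow_add, Finset.sum_erase_add _ _ hi]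
  have h2 : ∀ j ∈ I, j ≠ i → p j ((X ^ (∑ j ∈ I.erase i, M j) * V i) • x i) = 0 := by
    intro j hj hji
    rw [map_smul, (hx i hi).2.2 j hj hji, smul_zero]
  have h3 : (X ^ (∑ j ∈ I.erase i, M j) * V i) • x i ∈ G.toSubmodule :=
    G.toSubmodule.smul_mem _ (hx i hi).1
  refine ⟨h3, h1, h2, ?_⟩
  rw [← sub_eq_zero]
  refine h.inj _ (G.a_sub_smul_mem _ h3) fun j hj => ?_
  rw [mul_comm, (hp j).apply_a_sub]
  by_cases hji : j = i
  · subst hji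
    have := RankOne.aFun_X_pow_mul (ρ j) (∑ i ∈ I, M i) 1
    rw [mul_one] at this
    rw [h1, this, RankOne.aFun_apply]
    simp
    ring
  · rw [h2 j hj hji, map_zero, mul_zero, sub_zero]

/-- A rank one quotient of an embedded cyclic module corresponds to one of the components. -/
theorem EmbedsGen.exists_of_quot (hp : ∀ i, IsRankOneHom (ρ i) (p i))
    (hr : Function.Injective fun i => ρ i + m i) {G H : ABSub E} {ψ : E} {I : Finset ι} {d : ℕ}
    (h : EmbedsGen p m H ψ I d) (hle : G.toSubmodule ≤ H.toSubmodule) {ν : ℂ}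
    (hν : Nonempty (ABIso (H.Quot G) (RankOne ν))) :
    ∃ i ∈ I, ν = ρ i + m i + d ∧ ∃ ψ', EmbedsGen p m G ψ' (I.erase i) (d + 1) := by
  obtain ⟨π, hπ, hsurj, hker⟩ := exists_rankOneHom_of_quot hν
  obtain ⟨N, x, hx⟩ := h.exists_dual hp hr
  have hexp : ∀ y (hy : y ∈ H.toSubmodule), (X ^ N : ℂ⟦X⟧) • y = ∑ i ∈ I, p i y • x i := by
    intro y hy
    rw [← sub_eq_zero]
    refine h.inj _ (sub_mem (H.toSubmodule.smul_mem _ hy)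
      (Submodule.sum_mem _ fun i hi => H.toSubmodule.smul_mem _ (hx i hi).1)) fun j hj => ?_
    rw [map_sub, map_sum, map_smul, Finset.sum_eq_single_of_mem j hj, map_smul, (hx j hj).2.1,
      smul_eq_mul, smul_eq_mul, mul_comm, sub_self]
    intro i hi hij
    rw [map_smul, (hx i hi).2.2.1 j hj hij.symm, smul_zero]
  let s : ι → ℂ⟦X⟧ := fun i => if hi : i ∈ I then π ⟨x i, (hx i hi).1⟩ else 0
  have hπexp : ∀ y : H.toSubmodule, X ^ N * π y = ∑ i ∈ I, p i y * s i := by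
    intro y
    have : (X ^ N : ℂ⟦X⟧) • y = ∑ i : I, p i y • ⟨x i, (hx i i.2).1⟩ := by
      apply Subtype.ext
      rw [Submodule.coe_smul, hexp y y.2, AddSubmonoidClass.coe_finsetSum, ← Finset.sum_coe_sort I]
      rfl
    rw [← smul_eq_mul, ← map_smul, this, map_sum, ← Finset.sum_coe_sort I]
    refine Finset.sum_congr rfl fun i _ => ?_
    rw [map_smul, smul_eq_mul]
    simp [s]
  -- As images of eigenvectors, the `s i` are eigenvectors in `E_ν`, which fixes their order.
  have hs : ∀ i ∈ I, s i = 0 ∨ ∃ n : ℕ, HasOrd n (s i) ∧ (n : ℂ) + ν = ρ i + N := by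
    intro i hi
    apply RankOne.eq_zero_or_hasOrd_of_aFun_eq
    have hsi : s i = π ⟨x i, (hx i hi).1⟩ := by simp [s, hi]
    have : a (⟨x i, (hx i hi).1⟩ : H.toSubmodule) = (C (ρ i + N) * X) • ⟨x i, (hx i hi).1⟩ :=
      Subtype.ext (hx i hi).2.2.2
    rw [hsi, ← hπ, this, map_smul, smul_eq_mul, mul_assoc]
  -- The generator `ψ` must map to a unit, since `π` is surjective.
  have hψ : HasOrd 0 (π ⟨ψ, h.mem⟩) := by
    obtain ⟨y, hy⟩ := hsurj 1
    have hgen : (ABSub.gen (⟨ψ, h.mem⟩ : H.toSubmodule)).toSubmodule = ⊤ := by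
      rw [eq_top_iff]
      rintro z -
      have : (ABSub.gen ψ).toSubmodule ≤
          (ABSub.gen (⟨ψ, h.mem⟩ : H.toSubmodule)).toSubmodule.map H.toSubmodule.subtype := by
        refine ABSub.gen_le ⟨_, ABSub.mem_gen _, rfl⟩ ?_
        rintro _ ⟨w, hw, rfl⟩
        exact ⟨a w, (ABSub.gen _).a_mem w hw, rfl⟩
      obtain ⟨w, hw, hwz⟩ := this (h.eq_gen.le z.2)
      exact (Subtype.ext hwz : w = z) ▸ hw
    have hψ0 : π ⟨ψ, h.mem⟩ ≠ 0 := fun h0 => by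
      have := hπ.eq_zero_of_mem_gen h0 (y := y) (by rw [hgen]; exact Submodule.mem_top)
      rw [hy] at this
      exact one_ne_zero this
    obtain ⟨n, hn⟩ := ABTheory.exists_hasOrd hψ0
    have hdvd : (X ^ n : ℂ⟦X⟧) ∣ π y := by
      refine hπ.dvd_of_mem_gen ?_ (by rw [hgen]; exact Submodule.mem_top)
      obtain ⟨U, -, hU⟩ := hn
      exact ⟨U, hU⟩
    rw [hy] at hdvd
    have : n = 0 := by
      by_contra hn0
      have := X_pow_dvd_iff.1 hdvd 0 (Nat.pos_of_ne_zero hn0)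
      simp at this
    exact this ▸ hn
  have hsum : HasOrd N (∑ i ∈ I, p i ψ * s i) := by
    rw [← hπexp ⟨ψ, h.mem⟩]
    simpa using (hasOrd_X_pow N).mul hψ
  choose! n hn using fun i (hi : i ∈ I) => or_iff_not_imp_left.1 (hs i hi)
  -- The term `i` has order `m i + d + n i = ρ i + m i + d + N - ν`. These are distinct, so a single
  -- term accounts for the order `N` of the sum.
  obtain ⟨i, hi, hiN⟩ := exists_hasOrd_of_sum (o := fun i => m i + d + n i) (fun i hi => by
    by_cases h0 : s i = 0
    · exact Or.inl (by rw [h0, mul_zero])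
    · exact Or.inr ((h.ord i hi).mul (hn i hi h0).1)) (fun i hi j hj h0i h0j hij => by
    have e1 := (hn i hi (right_ne_zero_of_mul h0i)).2
    have e2 := (hn j hj (right_ne_zero_of_mul h0j)).2
    refine hr ?_
    have e3 : ((m i + d + n i : ℕ) : ℂ) = (m j + d + n j : ℕ) := by exact_mod_cast hij
    push_cast at e3
    change ρ i + (m i : ℂ) = ρ j + m j
    linear_combination e2 - e1 + e3) hsum
  have hsi : s i ≠ 0 := right_ne_zero_of_mul hiN.ne_zero
  have hiord : m i + d + n i = N := by
    have h1 := (h.ord i hi).mul (hn i hi hsi).1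
    rcases lt_trichotomy (m i + d + n i) N with h | h | h
    · exact absurd (hiN.coeff_eq_zero h) h1.coeff_ne_zero
    · exact h
    · exact absurd (h1.coeff_eq_zero h) hiN.coeff_ne_zero
  have hνi : ν = ρ i + m i + d := by
    have e1 := (hn i hi hsi).2
    rw [← hiord] at e1
    push_cast at e1
    linear_combination e1
  obtain ⟨T, hT, hTψ⟩ := hψ.exists_aFun_eq ν
  refine ⟨i, hi, hνi, _, h.erase hp hr (i := i) (T := T) (by rw [hT, hνi]; simp) hle ?_ ?_ ?_⟩
  · have hmem := H.a_sub_smul_mem (X * T) h.mem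
    refine (hker ⟨_, hmem⟩).1 ?_
    change π (a ⟨ψ, h.mem⟩ - (X * T) • ⟨ψ, h.mem⟩) = 0
    rw [hπ.apply_a_sub, hTψ, sub_self]
  · intro R hR
    have := (hker (R • ⟨ψ, h.mem⟩)).2 hR
    rw [map_smul, smul_eq_mul] at this
    exact (mul_eq_zero.1 this).resolve_right hψ.ne_zero
  · intro y hy hj
    refine h.inj y (hle hy) fun l hl => ?_
    by_cases hli : l = i
    · subst hli
      have h1 := hπexp ⟨y, hle hy⟩
      rw [(hker ⟨y, hle hy⟩).2 hy, mul_zero, Finset.sum_eq_single_of_mem l hl] at h1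
      · exact (mul_eq_zero.1 h1.symm).resolve_right hsi
      · intro j hjI hjl
        rw [show p j y = 0 from hj j (Finset.mem_erase.2 ⟨hjl, hjI⟩), zero_mul]
    · exact hj l (Finset.mem_erase.2 ⟨hli, hl⟩)

/-- The numbers of every Jordan–Hölder sequence are those of the family, up to order and twist. -/
theorem IsDistinctFamily.exists_of_isJordanHolderWith [Fintype ι] (h : IsDistinctFamily φ p ρ m)
    (hφ : (ABSub.gen φ).toSubmodule = ⊤) (hinj : ∀ x, (∀ i, p i x = 0) → x = 0)
    {k : ℕ} {F : Fin (k + 1) → ABSub E} {ν : Fin k → ℂ} (hF : IsJordanHolderWith F ν) :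
    Fintype.card ι = k ∧
      ∃ g : ι → Fin k, ∀ i, ν (g i) + ((g i : ℕ) + 1 : ℂ) = ρ i + m i + k := by
  -- `I` holds the components that survive in `F j`; each index already removed is matched with a
  -- term of the sequence.
  have key : ∀ j : Fin (k + 1), ∃ (I : Finset ι) (ψ : E), EmbedsGen p m (F j) ψ I (k - j) ∧
      I.card + (k - j) = Fintype.card ι ∧
      ∀ i ∉ I, ∃ l : Fin k, ν l + ((l : ℕ) + 1 : ℂ) = ρ i + m i + k := by
    intro j
    induction j using Fin.reverseInduction with
    | last =>
      refine ⟨Finset.univ, φ, ?_, by simp, by simp⟩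
      simpa using h.embedsGen hφ hinj hF.1.2.1
    | cast j ih =>
      obtain ⟨I, ψ, hψ, hI, hν⟩ := ih
      obtain ⟨i, hi, hνi, ψ', hψ'⟩ :=
        hψ.exists_of_quot h.hom h.injective (hF.1.2.2.1 j) (hF.2 j)
      have hj := j.2
      have hd : k - (j.succ : ℕ) + 1 = k - (j.castSucc : ℕ) := by
        simp only [Fin.val_castSucc, Fin.val_succ]
        omega
      refine ⟨I.erase i, ψ', hd ▸ hψ', ?_, fun l hl => ?_⟩
      · rw [← hd, ← hI, ← Finset.card_erase_add_one hi]
        omega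
      · by_cases hli : l = i
        · subst hli
          refine ⟨j, ?_⟩
          rw [hνi, Fin.val_succ, Nat.cast_sub hj]
          push_cast
          ring
        · exact hν l fun hlI => hl (Finset.mem_erase.2 ⟨hli, hlI⟩)
  obtain ⟨I, ψ, hψ, hI, hν⟩ := key 0
  have hψ0 : ψ = 0 := by
    have := hψ.mem
    rwa [hF.1.1, Submodule.mem_bot] at this
  have hI0 : I = ∅ := Finset.eq_empty_of_forall_notMem fun i hi => by
    apply (hψ.ord i hi).ne_zero
    rw [hψ0, map_zero]
  subst hI0
  refine ⟨by simpa using hI.symm, ?_⟩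
  choose g hg using fun i => hν i (Finset.notMem_empty i)
  exact ⟨g, hg⟩

end Uniqueness

/-! ### Semi-simple modules: distinct families and extension of morphisms -/

section Semisimple

theorem eq_zero_of_forall_X_pow_smul {M : Type*} [AddCommGroup M] [Module ℂ⟦X⟧ M]
    [Module.Free ℂ⟦X⟧ M] {x : M} (h : ∀ n : ℕ, ∃ y : M, x = (X ^ n : ℂ⟦X⟧) • y) : x = 0 := by
  let b := Module.Free.chooseBasis ℂ⟦X⟧ M
  refine b.ext_elem fun i => PowerSeries.ext fun n => ?_
  obtain ⟨y, rfl⟩ := h (n + 1)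
  rw [map_smul, Finsupp.smul_apply, smul_eq_mul, coeff_X_pow_mul', if_neg (by omega)]
  simp

/-- A regular module of rank one is isomorphic to some `E_μ`. -/
theorem exists_rankOneHom_of_isRegular (M : ABModule) (hreg : IsRegular M)
    (h1 : Module.finrank ℂ⟦X⟧ M = 1) :
    ∃ (μ : ℂ) (p : M →ₗ[ℂ⟦X⟧] ℂ⟦X⟧), IsRankOneHom μ p ∧ Function.Injective p := by
  let e : M ≃ₗ[ℂ⟦X⟧] ℂ⟦X⟧ := LinearEquiv.ofFinrankEq M ℂ⟦X⟧ (by rw [h1, Module.finrank_self])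
  let x₀ : M := e.symm 1
  have hx : ∀ x : M, x = e x • x₀ := fun x => by
    apply e.injective
    rw [map_smul, LinearEquiv.apply_symm_apply, smul_eq_mul, mul_one]
  have ha := hx (a x₀)
  set S : ℂ⟦X⟧ := e (a x₀) with hS
  -- If `S` were a unit, then `a x₀ = S x₀` would make the image of `x₀` divisible by every power of
  -- `b`, as `a` maps `b ^ n N` into `b ^ (n + 1) N`.
  have hS0 : constantCoeff S = 0 := by
    by_contra hc
    obtain ⟨N, i, hi, hN⟩ := hreg
    let i' : M →ₗ[ℂ⟦X⟧] N := i.toLinearMap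
    have hia : a (i' x₀) = S • i' x₀ := by
      rw [← map_smul, ← ha]
      exact (i.map_a x₀).symm
    have hdiv : ∀ n : ℕ, ∃ y : N, i' x₀ = (X ^ n : ℂ⟦X⟧) • y := by
      intro n
      induction n with
      | zero => exact ⟨i' x₀, by simp⟩
      | succ n ih =>
        obtain ⟨y, hy⟩ := ih
        obtain ⟨z, hz⟩ := hN y
        have h2 : (X ^ n : ℂ⟦X⟧) • (S • y) = (X ^ n : ℂ⟦X⟧) • ((X : ℂ⟦X⟧) • (z + (n : ℂ⟦X⟧) • y)) := by
          rw [hy, ABAction.a_smul, hz] at hia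
          rw [smul_smul, mul_comm, ← smul_smul, ← hia, smul_add, smul_add, smul_smul _ _ y,
            smul_smul _ _ y]
          congr 2
          cases n with
          | zero => simp
          | succ n =>
            rw [Derivation.leibniz_pow]
            simp
            ring
        have h3 := smul_right_injective N (pow_ne_zero n X_ne_zero) h2
        refine ⟨S⁻¹ • (z + (n : ℂ⟦X⟧) • y), ?_⟩
        have h4 : (X : ℂ⟦X⟧) • S⁻¹ • (z + (n : ℂ⟦X⟧) • y) = y := by
          rw [smul_comm, ← h3, smul_smul, PowerSeries.inv_mul_cancel S hc, one_smul]
        rw [hy, pow_succ, mul_smul, h4]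
    have h0 : i' x₀ = 0 := eq_zero_of_forall_X_pow_smul hdiv
    have : x₀ = 0 := hi (h0.trans (map_zero i').symm)
    exact one_ne_zero (e.symm.map_eq_zero_iff.1 this)
  obtain ⟨T, hT⟩ := X_dvd_iff.2 hS0
  obtain ⟨g, hg⟩ : X ∣ T - C (constantCoeff T) := X_dvd_iff.2 (by simp)
  -- Rescaling by `V` removes the non-constant part of `T`.
  obtain ⟨V, hV0, hV⟩ := exists_derivative_eq_mul g
  have haV : RankOne.aFun (constantCoeff T) V = S * V := by
    rw [RankOne.aFun_apply, hV, hT]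
    linear_combination -X * V * hg
  refine ⟨constantCoeff T, V • e.toLinearMap, fun x => ?_, ?_⟩
  · have : e (a x) = e x * S + X ^ 2 * PowerSeries.derivative ℂ (e x) := by
      conv_lhs => rw [hx x]
      rw [ABAction.a_smul, map_add, map_smul, map_smul, LinearEquiv.apply_symm_apply, ← hS]
      simp
    change V * e (a x) = RankOne.aFun _ (V * e x)
    rw [this, mul_comm V (e x), RankOne.aFun_mul, haV]
    ring
  · intro x y hxy
    have hV1 : V ≠ 0 := by
      rintro rfl
      exact hV0 (map_zero _)
    exact e.injective (mul_left_cancel₀ hV1 hxy)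

variable {E : Type*} [AddCommGroup E] [Module ℂ E] [Module ℂ⟦X⟧ E] [IsScalarTower ℂ ℂ⟦X⟧ E]
  [ABAction E]

theorem IsSemisimple.exists_rankOneHom (h : IsSemisimple E) :
    ∃ (n : ℕ) (μ : Fin n → ℂ) (p : Fin n → E →ₗ[ℂ⟦X⟧] ℂ⟦X⟧),
      (∀ i, IsRankOneHom (μ i) (p i)) ∧ ∀ x, (∀ i, p i x = 0) → x = 0 := by
  obtain ⟨n, M, hM, f, hf⟩ := h
  choose μ q hq hqi using fun i => exists_rankOneHom_of_isRegular (M i) (hM i).1 (hM i).2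
  let f' : E →ₗ[ℂ⟦X⟧] ∀ i, M i := f.toLinearMap
  refine ⟨n, μ, fun i => q i ∘ₗ LinearMap.proj i ∘ₗ f', fun i x => ?_, fun x hx => ?_⟩
  · have : f' (a x) = a (f' x) := f.map_a x
    change q i (f' (a x) i) = RankOne.aFun _ (q i (f' x i))
    rw [this, ← hq]
    rfl
  · refine hf ((funext fun i => hqi i ?_ : f' x = 0).trans (map_zero f').symm)
    exact (hx i).trans (map_zero (q i)).symm

theorem rankOne_isRegular (μ : ℂ) [Module.Free ℂ⟦X⟧ (RankOne μ)] [Module.Finite ℂ⟦X⟧ (RankOne μ)] :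
    IsRegular (RankOne μ) := by
  refine ⟨⟨RankOne μ⟩, ⟨LinearMap.id, fun _ => rfl⟩, Function.injective_id, fun (S : ℂ⟦X⟧) => ?_⟩
  change ∃ R : ℂ⟦X⟧, RankOne.aFun μ S = X * R
  refine ⟨X * PowerSeries.derivative ℂ S + C μ * S, ?_⟩
  rw [RankOne.aFun_apply]
  ring

theorem isSemisimple_of_rankOneHom {n : ℕ} {μ : Fin n → ℂ} {p : Fin n → E →ₗ[ℂ⟦X⟧] ℂ⟦X⟧}
    (hp : ∀ i, IsRankOneHom (μ i) (p i)) (hinj : ∀ x, (∀ i, p i x = 0) → x = 0) :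
    IsSemisimple E := by
  have hfree : ∀ μ, Module.Free ℂ⟦X⟧ (RankOne μ) := fun μ =>
    inferInstanceAs (Module.Free ℂ⟦X⟧ ℂ⟦X⟧)
  have hfin : ∀ μ, Module.Finite ℂ⟦X⟧ (RankOne μ) := fun μ =>
    inferInstanceAs (Module.Finite ℂ⟦X⟧ ℂ⟦X⟧)
  refine ⟨n, fun i => ⟨RankOne (μ i)⟩, fun i => ⟨rankOne_isRegular (μ i), Module.finrank_self ℂ⟦X⟧⟩,
    ⟨LinearMap.pi p, fun x => funext fun i => hp i x⟩, ?_⟩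
  rw [injective_iff_map_eq_zero]
  intro x hx
  exact hinj x fun i => congrFun hx i

/-- A family with distinct numbers can be enlarged so that its common kernel lies in that of a given
morphism. -/
theorem IsDistinctFamily.exists_extend {φ : E} (hφ : (ABSub.gen φ).toSubmodule = ⊤) {n : ℕ}
    {q : Fin n → E →ₗ[ℂ⟦X⟧] ℂ⟦X⟧} {ρ : Fin n → ℂ} {m : Fin n → ℕ} (h : IsDistinctFamily φ q ρ m)
    {p : E →ₗ[ℂ⟦X⟧] ℂ⟦X⟧} {μ : ℂ} (hp : IsRankOneHom μ p) :
    ∃ (n' : ℕ) (q' : Fin n' → E →ₗ[ℂ⟦X⟧] ℂ⟦X⟧) (ρ' : Fin n' → ℂ) (m' : Fin n' → ℕ),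
      IsDistinctFamily φ q' ρ' m' ∧
      ∀ x, (∀ i, q' i x = 0) → (∀ i, q i x = 0) ∧ p x = 0 := by
  -- `P` singles out the morphisms that can replace `p` next to the family `q`. One that kills `φ`
  -- is zero, and one with a new number can be adjoined; otherwise each has a number already present
  -- in the family.
  let P : (E →ₗ[ℂ⟦X⟧] ℂ⟦X⟧) → ℂ → Prop := fun p' μ' =>
    IsRankOneHom μ' p' ∧ ∀ x, (∀ i, q i x = 0) → p' x = 0 → p x = 0
  by_cases h0 : ∃ p' μ', P p' μ' ∧ p' φ = 0
  · obtain ⟨p', μ', hP, hp'⟩ := h0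
    exact ⟨n, q, ρ, m, h, fun x hx => ⟨hx, hP.2 x hx
      (hP.1.eq_zero_of_mem_gen hp' (by rw [hφ]; exact Submodule.mem_top))⟩⟩
  push Not at h0
  by_cases h1 : ∃ p' μ' m', P p' μ' ∧ HasOrd m' (p' φ) ∧ ∀ i, ρ i + m i ≠ μ' + m'
  · obtain ⟨p', μ', m', hP, hm', hne⟩ := h1
    refine ⟨n + 1, Fin.cons p' q, Fin.cons μ' ρ, Fin.cons m' m, ⟨?_, ?_, ?_⟩, fun x hx => ?_⟩
    · exact fun i => Fin.cases hP.1 h.hom i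
    · exact fun i => Fin.cases hm' h.ord i
    · intro i j
      refine Fin.cases ?_ (fun i => ?_) i <;> refine Fin.cases ?_ (fun j => ?_) j
      · simp
      · intro hc
        exact absurd hc.symm (hne j)
      · intro hc
        exact absurd hc (hne i)
      · intro hc
        exact congrArg Fin.succ (h.injective hc)
    · have hq : ∀ i, q i x = 0 := fun i => hx i.succ
      exact ⟨hq, hP.2 x hq (hx 0)⟩
  push Not at h1
  exfalso
  classical
  let A : Finset (Fin n) := Finset.univ.filter fun i =>
    ∃ p' μ' m', P p' μ' ∧ HasOrd m' (p' φ) ∧ ρ i + m i = μ' + m'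
  have hA : ∀ p' μ' m', P p' μ' → HasOrd m' (p' φ) → ∃ i ∈ A, ρ i + m i = μ' + m' := by
    intro p' μ' m' hP hm'
    obtain ⟨i, hi⟩ := h1 p' μ' m' hP hm'
    exact ⟨i, Finset.mem_filter.2 ⟨Finset.mem_univ i, p', μ', m', hP, hm', hi⟩, hi⟩
  have hPp : P p μ := ⟨hp, fun _ _ h => h⟩
  have hne : A.Nonempty := by
    obtain ⟨m₀, hm₀⟩ := exists_hasOrd (h0 p μ hPp)
    obtain ⟨i, hi, -⟩ := hA p μ m₀ hPp hm₀
    exact ⟨i, hi⟩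
  -- Among the finitely many numbers reached by such replacements, take one of largest real part.
  obtain ⟨i, hi, hmax⟩ := A.exists_max_image (fun i => (ρ i + m i).re) hne
  obtain ⟨-, p', μ', m', hP, hm', hi'⟩ := Finset.mem_filter.1 hi
  -- Both terms of `p''` are morphisms to `E_{μ' - m i}` and have the same order at `φ`; `c` is the
  -- ratio of their leading coefficients. The cancellation gives a replacement with a larger number,
  -- a contradiction.
  let c : ℂ := coeff (m i + m') (X ^ m i * p' φ) / coeff (m i + m') (X ^ m' * q i φ)
  let p'' : E →ₗ[ℂ⟦X⟧] ℂ⟦X⟧ := (X ^ m i : ℂ⟦X⟧) • p' - C c • ((X ^ m' : ℂ⟦X⟧) • q i)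
  have hord1 : HasOrd (m i + m') (X ^ m i * p' φ) := (hasOrd_X_pow _).mul hm'
  have hord2 : HasOrd (m i + m') (X ^ m' * q i φ) := by
    rw [add_comm]
    exact (hasOrd_X_pow _).mul (h.ord i)
  have hP'' : P p'' (μ' - m i) := by
    refine ⟨(hP.1.X_pow_smul (m i)).sub (IsRankOneHom.C_smul ?_ c), fun x hx hx'' => ?_⟩
    · have := (h.hom i).X_pow_smul m'
      rwa [show ρ i - m' = μ' - m i by linear_combination hi'] at this
    · refine hP.2 x hx ?_
      have hx3 : X ^ m i * p' x - C c * (X ^ m' * q i x) = 0 := hx''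
      rw [hx i, mul_zero, mul_zero, sub_zero] at hx3
      exact (mul_eq_zero.1 hx3).resolve_left (pow_ne_zero _ X_ne_zero)
  obtain ⟨m'', hm''⟩ := exists_hasOrd (h0 p'' _ hP'')
  have hφ'' : p'' φ = X ^ m i * p' φ - C c * (X ^ m' * q i φ) := rfl
  have hlt : m i + m' < m'' := by
    by_contra hc
    refine hm''.coeff_ne_zero ?_
    rw [hφ'', map_sub, coeff_C_mul]
    rcases (not_lt.1 hc).lt_or_eq with hlt | heq
    · rw [hord1.coeff_eq_zero hlt, hord2.coeff_eq_zero hlt, mul_zero, sub_zero]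
    · rw [heq, div_mul_cancel₀ _ hord2.coeff_ne_zero, sub_self]
  obtain ⟨i'', hi''A, hi''⟩ := hA p'' _ m'' hP'' hm''
  have h2 := hmax i'' hi''A
  simp only [hi'', hi'] at h2
  have h3 : ((m i + m' : ℕ) : ℝ) < m'' := by exact_mod_cast hlt
  push_cast at h3
  simp at h2
  linarith

theorem exists_isDistinctFamily {φ : E} (hφ : (ABSub.gen φ).toSubmodule = ⊤) (h : IsSemisimple E) :
    ∃ (n : ℕ) (q : Fin n → E →ₗ[ℂ⟦X⟧] ℂ⟦X⟧) (ρ : Fin n → ℂ) (m : Fin n → ℕ),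
      IsDistinctFamily φ q ρ m ∧ ∀ x, (∀ i, q i x = 0) → x = 0 := by
  classical
  obtain ⟨N, μ, p, hp, hinj⟩ := h.exists_rankOneHom
  have key : ∀ s : Finset (Fin N), ∃ (n : ℕ) (q : Fin n → E →ₗ[ℂ⟦X⟧] ℂ⟦X⟧) (ρ : Fin n → ℂ)
      (m : Fin n → ℕ), IsDistinctFamily φ q ρ m ∧ ∀ x, (∀ i, q i x = 0) → ∀ i ∈ s, p i x = 0 := by
    intro s
    induction s using Finset.induction_on with
    | empty =>
      exact ⟨0, Fin.elim0, Fin.elim0, Fin.elim0,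
        ⟨fun i => i.elim0, fun i => i.elim0, fun i => i.elim0⟩, by simp⟩
    | insert j s _ ih =>
      obtain ⟨n, q, ρ, m, hq, hqs⟩ := ih
      obtain ⟨n', q', ρ', m', hq', hqq⟩ := hq.exists_extend hφ (hp j)
      refine ⟨n', q', ρ', m', hq', fun x hx i hi => ?_⟩
      rcases Finset.mem_insert.1 hi with rfl | hi
      · exact (hqq x hx).2
      · exact hqs x (hqq x hx).1 i hi
  obtain ⟨n, q, ρ, m, hq, hqs⟩ := key Finset.univ
  exact ⟨n, q, ρ, m, hq, fun x hx => hinj x fun i => hqs x hx i (Finset.mem_univ i)⟩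

/-- Morphisms to rank one modules extend along extensions by `E_ν`, if `ν` is not in the way. -/
theorem exists_extension_rankOneHom {G H : ABSub E} (hle : G.toSubmodule ≤ H.toSubmodule) {ν ρ : ℂ}
    {π : H.toSubmodule →ₗ[ℂ⟦X⟧] ℂ⟦X⟧} (hπ : IsRankOneHom ν π) (hsurj : Function.Surjective π)
    (hker : ∀ x, π x = 0 ↔ (x : E) ∈ G.toSubmodule)
    {p : G.toSubmodule →ₗ[ℂ⟦X⟧] ℂ⟦X⟧} (hp : IsRankOneHom ρ p) (hρ : ∀ n : ℕ, (n : ℂ) + ρ - 1 ≠ ν) :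
    ∃ q : H.toSubmodule →ₗ[ℂ⟦X⟧] ℂ⟦X⟧, IsRankOneHom (ρ - 1) q ∧
      ∀ x (hx : x ∈ G.toSubmodule), q ⟨x, hle hx⟩ = X * p ⟨x, hx⟩ := by
  obtain ⟨φ, hφ⟩ := hsurj 1
  -- A `ℂ⟦X⟧`-linear projection onto `G` along `φ`, which need not commute with `a`.
  let s : H.toSubmodule →ₗ[ℂ⟦X⟧] G.toSubmodule :=
    (H.toSubmodule.subtype ∘ₗ (LinearMap.id - π.smulRight φ)).codRestrict G.toSubmodule fun x => by
      refine (hker (x - π x • φ)).1 ?_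
      simp [hφ]
  have hs : ∀ x, (s x : E) = x - π x • (φ : E) := fun x => rfl
  let z : G.toSubmodule := ⟨a φ - (C ν * X) • (φ : E), by
    refine (hker (a φ - (C ν * X) • φ)).1 ?_
    rw [map_sub, hπ, map_smul, hφ, RankOne.aFun_apply]
    simp⟩
  -- `u` is the value of `q` at `φ`, forced by `(a - ν b) φ = z`. The factor `X` in front of `p z`
  -- is what makes the equation solvable in degree `0`.
  let u : ℂ⟦X⟧ := PowerSeries.mk fun n => coeff n (p z) / ((n : ℂ) + (ρ - 1) - ν)
  have hu : RankOne.aFun (ρ - 1) u = C ν * X * u + X * p z := by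
    ext n
    cases n with
    | zero => rw [RankOne.coeff_zero_aFun]; simp
    | succ n =>
      rw [RankOne.coeff_succ_aFun, map_add, mul_assoc, coeff_C_mul, coeff_succ_X_mul,
        coeff_succ_X_mul, coeff_mk]
      have : (n : ℂ) + (ρ - 1) - ν ≠ 0 := by
        rw [sub_ne_zero, ← add_sub_assoc]
        exact hρ n
      field_simp
      ring
  refine ⟨LinearMap.mulRight ℂ⟦X⟧ u ∘ₗ π + LinearMap.mulLeft ℂ⟦X⟧ X ∘ₗ p ∘ₗ s, fun x => ?_,
    fun x hx => ?_⟩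
  · have hsa : s (a x) = π x • z + a (s x) := by
      apply Subtype.ext
      have h1 : ((a (s x) : G.toSubmodule) : E) = a (x : E) - a (π x • (φ : E)) := by
        rw [← map_sub, ← hs]
        rfl
      have h2 : ((a x : H.toSubmodule) : E) = a (x : E) := rfl
      have h3 : (z : E) = a (φ : E) - (C ν * X) • (φ : E) := rfl
      rw [hs, Submodule.coe_add, Submodule.coe_smul, h1, h2, h3, hπ, ABAction.a_smul,
        RankOne.aFun_apply, smul_sub, smul_smul, add_smul,
        show C ν * (X * π x) = π x * (C ν * X) by ring]
      abel
    change π (a x) * u + X * p (s (a x)) = RankOne.aFun _ (π x * u + X * p (s x))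
    have h4 := RankOne.aFun_X_pow_mul (ρ - 1) 1 (p (s x))
    rw [pow_one, Nat.cast_one, sub_add_cancel] at h4
    rw [hsa, map_add, map_smul, smul_eq_mul, hp, hπ, map_add, RankOne.aFun_mul, hu, h4,
      RankOne.aFun_apply ν]
    ring
  · have h0 : π ⟨x, hle hx⟩ = 0 := (hker _).2 hx
    have hsx : s ⟨x, hle hx⟩ = ⟨x, hx⟩ := Subtype.ext (by rw [hs, h0, zero_smul, sub_zero])
    change π ⟨x, hle hx⟩ * u + X * p (s ⟨x, hle hx⟩) = _
    rw [h0, zero_mul, zero_add, hsx]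

/-- A module with a Jordan–Hölder sequence whose twisted numbers strictly decrease is semi-simple. -/
theorem isSemisimple_of_strictAnti {k : ℕ} {F : Fin (k + 1) → ABSub E} {μ : Fin k → ℚ}
    (hF : IsJordanHolderWith F fun j => (μ j : ℂ))
    (hμ : StrictAnti fun j : Fin k => μ j + ((j : ℕ) + 1 : ℚ)) : IsSemisimple E := by
  -- Each extension lowers the parameter by one, so on `F j` the morphism born from the quotient `i`
  -- has parameter `μ i + (i + 1) - j`.
  have key : ∀ j : Fin (k + 1), ∃ q : Fin k → (F j).toSubmodule →ₗ[ℂ⟦X⟧] ℂ⟦X⟧,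
      (∀ i : Fin k, i.castSucc < j → IsRankOneHom ((μ i + ((i : ℕ) + 1) - (j : ℕ) : ℚ) : ℂ) (q i)) ∧
      ∀ x, (∀ i : Fin k, i.castSucc < j → q i x = 0) → x = 0 := by
    intro j
    induction j using Fin.induction with
    | zero =>
      refine ⟨0, fun i hi => absurd hi (by simp), fun x _ => Subtype.ext ?_⟩
      exact (Submodule.mem_bot _).1 (hF.1.1.le x.2)
    | succ j ih =>
      obtain ⟨q, hq, hinj⟩ := ih
      obtain ⟨π, hπ, hsurj, hker⟩ := exists_rankOneHom_of_quot (hF.2 j)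
      have hle := hF.1.2.2.1 j
      have hex : ∀ i : Fin k, ∃ q' : (F j.succ).toSubmodule →ₗ[ℂ⟦X⟧] ℂ⟦X⟧, i < j →
          IsRankOneHom ((μ i + ((i : ℕ) + 1) - (j.succ : ℕ) : ℚ) : ℂ) q' ∧
          ∀ x (hx : x ∈ (F j.castSucc).toSubmodule), q' ⟨x, hle hx⟩ = X * q i ⟨x, hx⟩ := by
        intro i
        by_cases hij : i < j
        · obtain ⟨q', hq', hx⟩ := exists_extension_rankOneHom hle hπ hsurj hker
            (hq i (Fin.castSucc_lt_castSucc_iff.2 hij)) fun n hn => by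
              change _ = ((μ j : ℚ) : ℂ) at hn
              rw [Fin.val_castSucc] at hn
              have h1 := hμ hij
              have h2 : (n : ℚ) + (μ i + ((i : ℕ) + 1) - (j : ℕ)) - 1 = μ j := by
                exact_mod_cast hn
              have h3 : (0 : ℚ) ≤ n := n.cast_nonneg
              simp only at h1
              linarith
          refine ⟨q', fun _ => ⟨?_, hx⟩⟩
          convert hq' using 1
          simp
          ring
        · exact ⟨0, fun h => absurd h hij⟩
      choose q' hq' using hex
      -- The new component is the projection to `F_{j+1} / F_j`; on its kernel the extended
      -- morphisms are `X` times the old ones.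
      refine ⟨Function.update q' j π, fun i hi => ?_, fun x hx => ?_⟩
      · rcases eq_or_ne i j with rfl | hij
        · rw [Function.update_self]
          convert hπ using 1
          simp
        · rw [Function.update_of_ne hij]
          exact (hq' i (lt_of_le_of_ne (Fin.castSucc_lt_succ_iff.1 hi) hij)).1
      · have hxj := hx j j.castSucc_lt_succ
        rw [Function.update_self, hker] at hxj
        have := hinj ⟨x, hxj⟩ fun i hi => by
          have hij : i < j := Fin.castSucc_lt_castSucc_iff.1 hi
          have h1 := hx i (hi.trans j.castSucc_lt_succ)
          rw [Function.update_of_ne hij.ne] at h1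
          have h2 := (hq' i hij).2 x hxj
          exact (mul_eq_zero.1 (h2.symm.trans h1)).resolve_left X_ne_zero
        exact Subtype.ext (congrArg Subtype.val this : (x : E) = 0)
  obtain ⟨q, hq, hinj⟩ := key (Fin.last k)
  let t : E →ₗ[ℂ⟦X⟧] (F (Fin.last k)).toSubmodule :=
    LinearMap.id.codRestrict _ fun x => by rw [hF.1.2.1]; exact Submodule.mem_top
  refine isSemisimple_of_rankOneHom (p := fun i => q i ∘ₗ t)
    (fun i x => hq i i.castSucc_lt_last (t x)) fun x hx => ?_
  exact congrArg Subtype.val (hinj (t x) fun i _ => hx i)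

end Semisimple

/-! ### Frescos: rationality and reordering -/

section Fresco

/-- The eigenvalues of `b⁻¹ a` on `Ξ_Λ^{(N)} ⊗ ℂ^p` are rational. -/
theorem Xi.exists_rat_of_a_eq {Λ : Finset ℚ} {N p : ℕ} {f : Xi Λ N p} (hf : f ≠ 0) {η : ℂ}
    (h : a f = (C η * X : ℂ⟦X⟧) • f) : ∃ r : ℚ, η = r := by
  classical
  have hex : ∃ (l : Λ) (v : Fin p), ∃ j, f l j v ≠ 0 := by
    by_contra! hc
    exact hf (funext fun l => funext fun j => funext fun v => hc l v j)
  obtain ⟨l, v, j₀, hj₀⟩ := hex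
  -- At the highest power of `log s` that occurs, the coordinate equation decouples and becomes that
  -- of `E_l`.
  obtain ⟨j, hj, hmax⟩ := (Finset.univ.filter fun j => f l j v ≠ 0).exists_max_image id
    ⟨j₀, by simpa using hj₀⟩
  have hcomp : Xi.aFun Λ N p f l j v = (C η * X) * f l j v := congrFun (congrFun (congrFun h l) j) v
  have hzero : ∀ hlt : (j : ℕ) + 1 < N + 1, f l ⟨j + 1, hlt⟩ v = 0 := fun hlt => by
    by_contra hc
    have := hmax ⟨j + 1, hlt⟩ (by simpa using hc)
    simp [Fin.le_def] at this
  have hlast : RankOne.aFun ((l : ℚ) : ℂ) (f l j v) = C η * (X * f l j v) := by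
    rw [RankOne.aFun_apply, ← mul_assoc (C η), ← hcomp]
    simp only [Xi.aFun]
    split_ifs with hlt
    · rw [hzero hlt]
      simp
    · simp
  obtain h0 | ⟨n, -, hn⟩ := RankOne.eq_zero_or_hasOrd_of_aFun_eq hlast
  · exact absurd h0 (by simpa using hj)
  · exact ⟨n + l, by rw [← hn]; push_cast; ring⟩

variable {E : Type*} [AddCommGroup E] [Module ℂ E] [Module ℂ⟦X⟧ E] [IsScalarTower ℂ ℂ⟦X⟧ E]
  [ABAction E]

theorem IsFresco.exists_hom (hE : IsFresco E) : ∃ (Λ : Finset ℚ) (N p : ℕ)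
    (f : E →ₗ[ℂ⟦X⟧] Xi Λ N p), (∀ x, f (a x) = a (f x)) ∧ Function.Injective f := by
  obtain ⟨Λ, N, p, φ, -, ⟨e⟩⟩ := hE
  refine ⟨Λ, N, p, (ABSub.gen φ).toSubmodule.subtype ∘ₗ e.toLinearEquiv.toLinearMap, fun x => ?_, ?_⟩
  · exact congrArg Subtype.val (e.map_a x)
  · exact Subtype.val_injective.comp e.toLinearEquiv.injective

theorem IsFresco.exists_generator (hE : IsFresco E) : ∃ φ : E, (ABSub.gen φ).toSubmodule = ⊤ := by
  obtain ⟨Λ, N, p, φ, -, ⟨e⟩⟩ := hE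
  let e' : E ≃ₗ[ℂ⟦X⟧] (ABSub.gen φ).toSubmodule := e.toLinearEquiv
  have he : ∀ x, e' (a x) = a (e' x) := e.map_a
  refine ⟨e'.symm ⟨φ, ABSub.mem_gen φ⟩, eq_top_iff.2 fun x _ => ?_⟩
  set ψ := e'.symm ⟨φ, ABSub.mem_gen φ⟩ with hψ
  have hle : (ABSub.gen φ).toSubmodule ≤ (ABSub.gen ψ).toSubmodule.map
      ((ABSub.gen φ).toSubmodule.subtype ∘ₗ e'.toLinearMap) := by
    refine ABSub.gen_le ⟨ψ, ABSub.mem_gen ψ, ?_⟩ ?_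
    · simp [hψ]
    · rintro _ ⟨w, hw, rfl⟩
      exact ⟨a w, (ABSub.gen ψ).a_mem w hw, congrArg Subtype.val (he w)⟩
  obtain ⟨w, hw, hwx⟩ := hle (e' x).2
  have : w = x := e'.injective (Subtype.ext hwx)
  exact this ▸ hw

/-- The dual vector `x i` is an eigenvector with value `ρ i + M`, and its image in `Ξ` is nonzero.
-/
theorem IsDistinctFamily.exists_rat {k : ℕ} {φ : E} {p : Fin k → E →ₗ[ℂ⟦X⟧] ℂ⟦X⟧}
    {ρ : Fin k → ℂ} {m : Fin k → ℕ} (h : IsDistinctFamily φ p ρ m) (hE : IsFresco E)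
    (hφ : (ABSub.gen φ).toSubmodule = ⊤) (hinj : ∀ x, (∀ i, p i x = 0) → x = 0) (i : Fin k) :
    ∃ r : ℚ, ρ i + m i = r := by
  obtain ⟨Λ, N, p', f, hfa, hf⟩ := hE.exists_hom
  obtain ⟨M, x, hx⟩ := (h.embedsGen hφ hinj (G := ABSub.gen φ) hφ).exists_dual h.hom h.injective
  obtain ⟨-, hxM, -, hxa⟩ := hx i (Finset.mem_univ i)
  have hfx : f (x i) ≠ 0 := fun h0 => by
    have : x i = 0 := hf (h0.trans (map_zero f).symm)
    rw [this, map_zero] at hxM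
    exact (hasOrd_X_pow M).ne_zero hxM.symm
  obtain ⟨r, hr⟩ := Xi.exists_rat_of_a_eq hfx (η := ρ i + M) (by rw [← hfa, hxa, map_smul])
  refine ⟨r - M + m i, ?_⟩
  push_cast
  linear_combination hr

theorem IsDistinctFamily.comp_equiv {ι κ : Type*} {φ : E} {p : ι → E →ₗ[ℂ⟦X⟧] ℂ⟦X⟧}
    {ρ : ι → ℂ} {m : ι → ℕ} (h : IsDistinctFamily φ p ρ m) (σ : κ ≃ ι) :
    IsDistinctFamily φ (p ∘ σ) (ρ ∘ σ) (m ∘ σ) :=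
  ⟨fun _ => h.hom _, fun _ => h.ord _, h.injective.comp σ.injective⟩

/-- Sort the family by decreasing `ρ i + m i`; distinctness makes the decrease strict. -/
theorem IsFresco.exists_strictAnti (hE : IsFresco E) (h : IsSemisimple E) :
    ∃ (k : ℕ) (F : Fin (k + 1) → ABSub E) (μ : Fin k → ℚ),
      IsJordanHolderWith F (fun j => (μ j : ℂ)) ∧
      StrictAnti (fun j : Fin k => μ j + ((j : ℕ) + 1 : ℚ)) := by
  obtain ⟨φ, hφ⟩ := hE.exists_generator
  obtain ⟨k, p, ρ, m, hp, hinj⟩ := exists_isDistinctFamily hφ h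
  choose r hr using hp.exists_rat hE hφ hinj
  have hrinj : Function.Injective r := fun i j hij => hp.injective (by
    change ρ i + m i = ρ j + m j
    rw [hr, hr, hij])
  let σ := Tuple.sort fun i => -r i
  have hσ : StrictMono fun i => -r (σ i) :=
    (Tuple.monotone_sort fun i => -r i).strictMono_of_injective
      ((neg_injective.comp hrinj).comp σ.injective)
  refine ⟨k, _, fun j => r (σ j) + k - ((j : ℕ) + 1), (hp.comp_equiv σ).isJordanHolderWith hφ
    (fun x hx => hinj x fun i => by simpa using hx (σ.symm i)) fun j => ?_, fun i j hij => ?_⟩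
  · push_cast
    rw [sub_add_cancel, ← hr]
    rfl
  · have := hσ hij
    simp only at this ⊢
    linarith

/-- By uniqueness, `g` matches the family with the terms of `ν`; the peeling is then redone in the
order prescribed by `σ`. -/
theorem IsFresco.exists_of_isTwistedPermutation (hE : IsFresco E) (h : IsSemisimple E) {k : ℕ}
    {F : Fin (k + 1) → ABSub E} {ν μ : Fin k → ℂ} (hF : IsJordanHolderWith F ν)
    (hμ : IsTwistedPermutation ν μ) : ∃ G : Fin (k + 1) → ABSub E, IsJordanHolderWith G μ := by
  obtain ⟨φ, hφ⟩ := hE.exists_generator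
  obtain ⟨n, p, ρ, m, hp, hinj⟩ := exists_isDistinctFamily hφ h
  obtain ⟨hn, g, hg⟩ := hp.exists_of_isJordanHolderWith hφ hinj hF
  have hgi : Function.Injective g := fun i j hij => hp.injective (by
    have hi := hg i
    rw [hij, hg j] at hi
    exact (add_right_cancel hi).symm)
  let e : Fin n ≃ Fin k := Equiv.ofBijective g
    ((Fintype.bijective_iff_injective_and_card g).2 ⟨hgi, by rw [hn, Fintype.card_fin]⟩)
  obtain ⟨σ, hσ⟩ := hμ
  refine ⟨_, (hp.comp_equiv (σ.trans e.symm)).isJordanHolderWith hφ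
    (fun x hx => hinj x fun i => by simpa using hx (σ.symm (e i))) fun j => ?_⟩
  have he : g (e.symm (σ j)) = σ j := e.apply_symm_apply (σ j)
  have := hg (e.symm (σ j))
  rw [he] at this
  rw [hσ, this]
  rfl

end Fresco
end ABTheory

end

theorem mainTheorem6 {E : Type*} [AddCommGroup E] [Module ℂ E] [Module ℂ⟦X⟧ E]
    [IsScalarTower ℂ ℂ⟦X⟧ E] [ABTheory.ABAction E] (hE : ABTheory.IsFresco E) :
    (∀ lam : ℚ, 0 < lam → lam ≤ 1 → ABTheory.IsPrimitive E {lam} →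
      (ABTheory.IsSemisimple E ↔
        ∃ (k : ℕ) (F : Fin (k + 1) → ABTheory.ABSub E) (μ : Fin k → ℚ),
          ABTheory.IsJordanHolderWith F (fun j => (μ j : ℂ)) ∧
          StrictAnti (fun j : Fin k => μ j + ((j : ℕ) + 1 : ℚ)))) ∧
    (ABTheory.IsSemisimple E →
      (∃ (k : ℕ) (F : Fin (k + 1) → ABTheory.ABSub E) (ν : Fin k → ℂ),
        ABTheory.IsJordanHolderWith F ν) ∧
      ∀ (k : ℕ) (F : Fin (k + 1) → ABTheory.ABSub E) (ν : Fin k → ℂ),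
        ABTheory.IsJordanHolderWith F ν →
        ∀ μ : Fin k → ℂ, ABTheory.IsTwistedPermutation ν μ →
          ∃ G : Fin (k + 1) → ABTheory.ABSub E, ABTheory.IsJordanHolderWith G μ) := by
  refine ⟨fun _ _ _ _ => ⟨hE.exists_strictAnti, ?_⟩, fun h => ⟨?_, ?_⟩⟩
  · rintro ⟨k, F, μ, hF, hμ⟩
    exact ABTheory.isSemisimple_of_strictAnti hF hμ
  · obtain ⟨k, F, μ, hF, -⟩ := hE.exists_strictAnti h
    exact ⟨k, F, _, hF⟩
  · exact fun k F ν hF μ hμ => hE.exists_of_isTwistedPermutation h hF hμ
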